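/- Let $S$ be a densely defined symmetric operator in a complex Hilbert space $\mathcal H$ with a gap $(a,b)\ni 0$, where $-\infty\le a<b<+\infty$: that is, $\langle f,Sf\rangle\ge b\|f\|^2$ for all $f\in\mathcal D(S)$ if $a=-\infty$, and $\|(S-\frac{a+b}{2})f\|\ge\frac{b-a}{2}\|f\|$ for all $f\in\mathcal D(S)$ if $a>-\infty$. Let $S_{\mathrm D}$ be a self-adjoint extension of $S$ whose resolvent set contains $(a,b)$ (so $S_{\mathrm D}^{-1}$ is everywhere defined and bounded), and assume $\dim\ker S^*=\infty$. For a self-adjoint operator $T$ in a Hilbert subspace of $\ker S^*$ let $S_T$ be the restriction of $S^*$ to $$\mathcal D(S_T)=\{f+S_{\mathrm D}^{-1}(Tv+w)+v \;:\; f\in\mathcal D(\overline S),\ v\in\mathcal D(T),\ w\in\ker S^*\cap\mathcal D(T)^\perp\}.$$ Let $(\lambda_n)_{n\in\mathcal N}$ be a finite or countably infinite family of points of $(a,b)$, possibly with repetitions. Then there is an orthonormal system $(v_n)_{n\in\mathcal N}$ in $\mathcal D(S^*)$ with $S^*v_n=\lambda_nv_n$ for all $n$. For every such system, put $u_n=(S_{\mathrm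 D}-\lambda_n)S_{\mathrm D}^{-1}v_n$ and $U=\overline{\mathrm{span}}\{u_n : n\in\mathcal N\}$. The $u_n$ are linearly independent, $U\subset\ker S^*$, and there is a linear operator $T_0:\mathrm{span}\{u_n\}\to U$ with matrix elements $$\langle u_m,T_0u_n\rangle=\lambda_n\langle v_m,v_n\rangle-\lambda_m\lambda_n\langle v_m,S_{\mathrm D}^{-1}v_n\rangle .$$ The closure $\overline{T_0}$ is self-adjoint in $U$ if all $\lambda_n$ lie in a compact subset of $(a,b)$, and in general $T_0$ has at least one self-adjoint extension in $U$. For every self-adjoint extension $T$ of $T_0$ in $U$ (in particular for $T=\overline{T_0}$ whenever this operator is self-adjoint), $S_T$ is a self-adjoint extension of $S$, every $\lambda_n$ is an eigenvalue of $S_T$, and the multiplicity of $\lambda_n$ as an eigenvalue of $S_T$ is at least the number (possibly infinite) of indices $k$ with $\lambda_k=\lambda_n$. -/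

import Mathlib

open scoped LinearPMap

namespace GapExtension

noncomputable section

variable {H : Type*} [NormedAddCommGroup H] [InnerProductSpace ℂ H]

/-- The open interval `(a, b)`, finite or unbounded below (`a = ⊥` stands for `a = -∞`). -/
def gapInterval (a : WithBot ℝ) (b : ℝ) : Set ℝ := {x | a < (x : WithBot ℝ) ∧ x < b}

/-- `(a, b)` is a gap of the symmetric operator `S`: `⟨f, S f⟩ ≥ b ‖f‖²` on the domain of `S` if
`a = -∞`, and `‖(S - (a + b) / 2) f‖ ≥ ((b - a) / 2) ‖f‖` on the domain of `S` if `a` is finite. -/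
def HasGap (S : H →ₗ.[ℂ] H) (a : WithBot ℝ) (b : ℝ) : Prop :=
  (a = ⊥ → ∀ f : S.domain, b * ‖(f : H)‖ ^ 2 ≤ (inner ℂ (f : H) (S f)).re) ∧
  ∀ r : ℝ, a = (r : WithBot ℝ) → ∀ f : S.domain,
    (b - r) / 2 * ‖(f : H)‖ ≤ ‖S f - (((r + b) / 2 : ℝ) : ℂ) • (f : H)‖

/-- `R` is an everywhere defined bounded inverse of `A - z`. -/
def IsBoundedInverse (A : H →ₗ.[ℂ] H) (z : ℂ) (R : H →L[ℂ] H) : Prop :=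
  (∀ x : H, ∃ h : R x ∈ A.domain, A ⟨R x, h⟩ - z • R x = x) ∧
  ∀ g : A.domain, R (A g - z • (g : H)) = g

/-- `z` belongs to the resolvent set of `A`. -/
def InResolventSet (A : H →ₗ.[ℂ] H) (z : ℂ) : Prop := ∃ R : H →L[ℂ] H, IsBoundedInverse A z R

open scoped Classical in
/-- The inverse `A⁻¹` as an everywhere defined bounded operator, if it exists (otherwise `0`). -/
def boundedInverse (A : H →ₗ.[ℂ] H) : H →L[ℂ] H :=
  if h : InResolventSet A 0 then h.choose else 0

/-- The subspace `ker (A - z)` of `H`. -/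
def eigenspace (A : H →ₗ.[ℂ] H) (z : ℂ) : Submodule ℂ H :=
  (LinearMap.ker (A.toFun - z • A.domain.subtype)).map A.domain.subtype

/-- The vectors `u_n = (D - λ_n) D⁻¹ v_n = v_n - λ_n D⁻¹ v_n`. -/
def uVec (D : H →ₗ.[ℂ] H) {ι : Type*} (lam : ι → ℝ) (v : ι → H) (n : ι) : H :=
  v n - (lam n : ℂ) • boundedInverse D (v n)

/-- The Hilbert subspace `U`, the closed linear span of the `u_n`. -/
abbrev uSpace (D : H →ₗ.[ℂ] H) {ι : Type*} (lam : ι → ℝ) (v : ι → H) : Submodule ℂ H :=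
  (Submodule.span ℂ (Set.range (uVec D lam v))).topologicalClosure

/-- The numbers `λ_n ⟨v_m, v_n⟩ - λ_m λ_n ⟨v_m, D⁻¹ v_n⟩`. -/
def matrixElement (D : H →ₗ.[ℂ] H) {ι : Type*} (lam : ι → ℝ) (v : ι → H) (m n : ι) : ℂ :=
  (lam n : ℂ) * inner ℂ (v m) (v n) -
    (lam m : ℂ) * (lam n : ℂ) * inner ℂ (v m) (boundedInverse D (v n))

/-- The operator in the Hilbert space `U`, with domain the linear span of the `u_n`, obtained by
linear extension from the matrix elements: its graph is spanned by the pairs `(u_n, y)`, where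
`y` in `U` satisfies `⟨u_m, y⟩ = λ_n ⟨v_m, v_n⟩ - λ_m λ_n ⟨v_m, D⁻¹ v_n⟩` for all `m`. -/
def birmanCore (D : H →ₗ.[ℂ] H) {ι : Type*} (lam : ι → ℝ) (v : ι → H) :
    uSpace D lam v →ₗ.[ℂ] uSpace D lam v :=
  (Submodule.span ℂ {p : uSpace D lam v × uSpace D lam v |
    ∃ n : ι, (p.1 : H) = uVec D lam v n ∧
      ∀ m : ι, inner ℂ (uVec D lam v m) (p.2 : H) = matrixElement D lam v m n}).toLinearPMap

variable [CompleteSpace H]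

/-- `D` is a distinguished extension of `S`: a self-adjoint extension of `S` whose resolvent set
contains the gap `(a, b)`. -/
structure IsDistinguishedExtension (S D : H →ₗ.[ℂ] H) (a : WithBot ℝ) (b : ℝ) : Prop where
  extends_op : S ≤ D
  selfAdjoint : IsSelfAdjoint D
  gap_subset : ∀ x ∈ gapInterval a b, InResolventSet D (x : ℂ)

/-- The set of all `f + D⁻¹ (T v + w) + v` with `f` in the domain of the closure of `S`, `v` in the
domain of `T`, and `w` in `ker S*` orthogonal to the domain of `T`. -/
def extensionDomain (S D : H →ₗ.[ℂ] H) (U : Submodule ℂ H) (T : U →ₗ.[ℂ] U) :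
    Submodule ℂ H where
  carrier := {x | ∃ f ∈ S.closure.domain, ∃ v : T.domain, ∃ w ∈ eigenspace S† 0,
    (∀ v' : T.domain, inner ℂ ((v' : U) : H) w = 0) ∧
    x = f + boundedInverse D ((T v : H) + w) + ((v : U) : H)}
  zero_mem' := ⟨0, zero_mem _, 0, 0, zero_mem _, by simp, by simp⟩
  add_mem' := by
    rintro x y ⟨f, hf, v, w, hw, hvw, rfl⟩ ⟨f', hf', v', w', hw', hvw', rfl⟩
    refine ⟨f + f', add_mem hf hf', v + v', w + w', add_mem hw hw', ?_, ?_⟩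
    · intro z
      rw [inner_add_right, hvw z, hvw' z, add_zero]
    · simp only [LinearPMap.map_add, map_add, Submodule.coe_add]
      abel
  smul_mem' := by
    rintro c x ⟨f, hf, v, w, hw, hvw, rfl⟩
    refine ⟨c • f, Submodule.smul_mem _ c hf, c • v, c • w, Submodule.smul_mem _ c hw, ?_, ?_⟩
    · intro z
      rw [inner_smul_right, hvw z, mul_zero]
    · simp only [LinearPMap.map_smul, map_smul, map_add, Submodule.coe_smul, smul_add]

/-- The restriction `S_T` of `S*` labelled by the operator `T` in the subspace `U` of `ker S*`. -/
def extensionOf (S D : H →ₗ.[ℂ] H) (U : Submodule ℂ H) (T : U →ₗ.[ℂ] U) : H →ₗ.[ℂ] H :=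
  S†.domRestrict (extensionDomain S D U T)

end

end GapExtension

/-! Write R for the inverse of D, P for the projection onto U, V for the closed span of the v_n. A
pair (g, k) lies in the graph of the extension labelled by T iff g - R k is in U and (g - R k, P k)
is in the graph of T (`mem_graph_extensionOf_iff`). Hence v_n is an eigenvector for λ_n as soon as T
u_n = P(λ_n v_n), which is what the matrix elements prescribe. A self-adjoint T gives a self-adjoint
extension, and orthonormality of the v_n gives the multiplicities.

The work is to find a self-adjoint T. There is a quadratic polynomial q(t) = α t² - β t + γ with
q(D) ≥ 0, q < 0 on the gap and γ < 0: (t - a)(t - b), or t - b if a = -∞ (`exists_gapForm`). It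
enters through `gapForm` evaluated at (x, y) = (R p, p), nonnegative, and at x in the span of the
v_n with y its image under v_n ↦ λ_n v_n, nonpositive. This conflict gives the independence of the
u_n and the estimates below.

Extend T_0 by zero on the vectors of U orthogonal to V (`extCore`). The result is symmetric because
the v_n are orthonormal. Its adjoint is contained in its closure (`adjoint_extCore_le`): the
V-component of an adjoint pair is an orthogonal series of multiples of (v_n, λ_n v_n), and the rest
is approximated by pairs coming from Uᗮ, the form supplying convergence. If the λ_n stay in a
compact subset of the gap, q is bounded away from 0 on them, which forces U ∩ Vᗮ = 0; no zero part
is added, and the closure of T_0 itself is self-adjoint (`extCore_eq_core`). -/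

namespace GapExtension

noncomputable section

variable {H : Type*} [NormedAddCommGroup H] [InnerProductSpace ℂ H]

/-! ### Adjoints of linear relations and self-adjointness in terms of graphs -/

section Graph

variable {E F : Type*} [NormedAddCommGroup E] [InnerProductSpace ℂ E]
  [NormedAddCommGroup F] [InnerProductSpace ℂ F]

theorem mem_adjoint_iff_inner_eq (g : Submodule ℂ (E × F)) (x : F × E) :
    x ∈ g.adjoint ↔ ∀ p ∈ g, inner ℂ p.2 x.1 = inner ℂ p.1 x.2 := by
  rw [Submodule.mem_adjoint_iff]
  exact ⟨fun h p hp => sub_eq_zero.1 (h p.1 p.2 hp), fun h a b hab => sub_eq_zero.2 (h (a, b) hab)⟩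

theorem mem_adjoint_span {s : Set (E × F)} {x : F × E} :
    x ∈ (Submodule.span ℂ s).adjoint ↔ ∀ p ∈ s, inner ℂ p.2 x.1 = inner ℂ p.1 x.2 := by
  rw [mem_adjoint_iff_inner_eq]
  refine ⟨fun h p hp => h p (Submodule.subset_span hp), fun h p hp => ?_⟩
  induction hp using Submodule.span_induction with
  | mem p hp => exact h p hp
  | zero => simp
  | add p q _ _ hp hq => simp only [Prod.fst_add, Prod.snd_add, inner_add_left, hp, hq]
  | smul c p _ hp => simp only [Prod.smul_fst, Prod.smul_snd, inner_smul_left, hp]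

theorem adjoint_topologicalClosure (g : Submodule ℂ (E × F)) :
    g.topologicalClosure.adjoint = g.adjoint := by
  ext x
  rw [mem_adjoint_iff_inner_eq, mem_adjoint_iff_inner_eq]
  refine ⟨fun h p hp => h p (g.le_topologicalClosure hp), fun h p hp => ?_⟩
  have hc : IsClosed {p : E × F | inner ℂ p.2 x.1 = inner ℂ p.1 x.2} :=
    isClosed_eq (by fun_prop) (by fun_prop)
  exact closure_minimal (show (g : Set (E × F)) ⊆ _ from h) hc hp

theorem isClosed_adjoint (g : Submodule ℂ (E × F)) : IsClosed (g.adjoint : Set (F × E)) := by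
  have : (g.adjoint : Set (F × E)) =
      ⋂ p ∈ g, {x : F × E | inner ℂ p.2 x.1 = inner ℂ p.1 x.2} := by
    ext x
    simp only [SetLike.mem_coe, mem_adjoint_iff_inner_eq, Set.mem_iInter, Set.mem_ofPred_eq]
  rw [this]
  exact isClosed_biInter fun p _ => isClosed_eq (by fun_prop) (by fun_prop)

/-- A densely defined subspace whose closure is its adjoint has a self-adjoint closure. -/
theorem exists_isSelfAdjoint_of_adjoint_eq [CompleteSpace E] (g : Submodule ℂ (E × E))
    (hd : Dense (g.map (LinearMap.fst ℂ E E) : Set E)) (hg : g.adjoint = g.topologicalClosure) :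
    ∃ T : E →ₗ.[ℂ] E, IsSelfAdjoint T ∧ T.graph = g.topologicalClosure := by
  have hgr : g.topologicalClosure.toLinearPMap.graph = g.topologicalClosure := by
    refine Submodule.toLinearPMap_graph_eq _ fun x hx hx0 => ?_
    -- A pair (0, y) in the closure lies in the adjoint, so y is orthogonal to the dense domain: the
    -- closure is single-valued.
    rw [← hg, mem_adjoint_iff_inner_eq] at hx
    refine hd.eq_zero_of_inner_right ℂ fun y hy => ?_
    obtain ⟨p, hp, rfl⟩ := hy
    simpa [hx0] using (hx p hp).symm
  refine ⟨_, ?_, hgr⟩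
  have hd' : Dense (g.topologicalClosure.toLinearPMap.domain : Set E) := by
    refine hd.mono ?_
    rw [Submodule.toLinearPMap_domain]
    exact Submodule.map_mono g.le_topologicalClosure
  rw [LinearPMap.isSelfAdjoint_def]
  apply LinearPMap.eq_of_eq_graph
  rw [LinearPMap.adjoint_graph_eq_graph_adjoint hd', hgr, adjoint_topologicalClosure, hg]

theorem graph_adjoint_eq_of_isSelfAdjoint [CompleteSpace E] {T : E →ₗ.[ℂ] E}
    (hT : IsSelfAdjoint T) : T.graph.adjoint = T.graph := by
  rw [← LinearPMap.adjoint_graph_eq_graph_adjoint hT.dense_domain, LinearPMap.isSelfAdjoint_def.1 hT]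

theorem isSelfAdjoint_of_graph_adjoint_eq [CompleteSpace E] {T : E →ₗ.[ℂ] E}
    (hd : Dense (T.domain : Set E)) (hT : T.graph.adjoint = T.graph) : IsSelfAdjoint T := by
  rw [LinearPMap.isSelfAdjoint_def]
  apply LinearPMap.eq_of_eq_graph
  rw [LinearPMap.adjoint_graph_eq_graph_adjoint hd, hT]

end Graph

/-! ### Expansion along an orthonormal system -/

section Orthonormal

variable {ι : Type*} {v : ι → H}

/-- The closed linear span of a family of vectors. -/
abbrev closedSpan (v : ι → H) : Submodule ℂ H :=
  (Submodule.span ℂ (Set.range v)).topologicalClosure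

theorem mem_closedSpan (v : ι → H) (n : ι) : v n ∈ closedSpan v :=
  Submodule.le_topologicalClosure _ (Submodule.subset_span ⟨n, rfl⟩)

theorem mem_closedSpan_orthogonal {x : H} :
    x ∈ (closedSpan v)ᗮ ↔ ∀ n, inner ℂ (v n) x = 0 := by
  rw [Submodule.orthogonal_closure, Submodule.mem_orthogonal]
  refine ⟨fun h n => h _ (Submodule.subset_span ⟨n, rfl⟩), fun h u hu => ?_⟩
  induction hu using Submodule.span_induction with
  | mem p hp => obtain ⟨n, rfl⟩ := hp; exact h n
  | zero => simp
  | add p q _ _ hp hq => simp only [inner_add_left, hp, hq, add_zero]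
  | smul c p _ hp => simp only [inner_smul_left, hp, mul_zero]

variable [CompleteSpace H]

theorem hasSum_inner_smul_starProjection (hv : Orthonormal ℂ v) (g : H) :
    HasSum (fun n => inner ℂ (v n) g • v n) ((closedSpan v).starProjection g) := by
  set V := closedSpan v
  let v' : ι → V := fun n => ⟨v n, mem_closedSpan v n⟩
  have hv' : Orthonormal ℂ v' := (V.subtypeₗᵢ.orthonormal_comp_iff (v := v')).1 hv
  have htop : ⊤ ≤ (Submodule.span ℂ (Set.range v')).topologicalClosure := by
    rw [top_le_iff, Submodule.topologicalClosure_eq_top_iff, Submodule.eq_bot_iff]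
    intro x hx
    have hx' : ∀ n, inner ℂ (v n) (x : H) = 0 := fun n =>
      (Submodule.mem_orthogonal _ _).1 hx (v' n) (Submodule.subset_span ⟨n, rfl⟩)
    have := Submodule.inner_right_of_mem_orthogonal x.2 (mem_closedSpan_orthogonal.2 hx')
    exact Subtype.ext (inner_self_eq_zero.1 this)
  have h := (HilbertBasis.mk hv' htop).hasSum_repr (V.orthogonalProjectionOnto g)
  have h2 := h.mapL V.subtypeL
  rw [Submodule.starProjection_apply]
  convert h2 using 1
  · funext n
    rw [map_smul, HilbertBasis.repr_apply_apply, HilbertBasis.coe_mk,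
      Submodule.inner_orthogonalProjectionOnto_eq_of_mem_left]
    rfl
  · rfl

end Orthonormal

/-! ### The quadratic form attached to the gap -/

section Form

/-- The quadratic form `α ‖y‖² - β Re ⟨y, x⟩ + γ ‖x‖²`. -/
def gapForm (α β γ : ℝ) (x y : H) : ℝ :=
  α * ‖y‖ ^ 2 - β * (inner ℂ y x : ℂ).re + γ * ‖x‖ ^ 2

/-- The form with coefficients `α`, `β`, `γ` separates the spectrum of `R⁻¹` from
the numbers `λ_n`. -/
structure Separates {ι : Type*} (R : H →L[ℂ] H) (lam : ι → ℝ) (α β γ : ℝ) : Prop where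
  nonneg : 0 ≤ α
  neg : γ < 0
  form_nonneg : ∀ p : H, 0 ≤ gapForm α β γ (R p) p
  lam_neg : ∀ n, α * lam n ^ 2 - β * lam n + γ < 0

variable {ι : Type*} {v : ι → H} {lam : ι → ℝ} {R : H →L[ℂ] H} {α β γ : ℝ}

theorem norm_sum_smul_sq (hv : Orthonormal ℂ v) (c : ι → ℂ) (s : Finset ι) :
    ‖∑ n ∈ s, c n • v n‖ ^ 2 = ∑ n ∈ s, ‖c n‖ ^ 2 := by
  have h := hv.inner_sum c c s
  rw [inner_self_eq_norm_sq_to_K] at h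
  have h2 : ∀ n, (starRingEnd ℂ) (c n) * c n = ((‖c n‖ ^ 2 : ℝ) : ℂ) := fun n => by
    rw [mul_comm, Complex.mul_conj, Complex.normSq_eq_norm_sq]
  simp only [h2] at h
  apply Complex.ofReal_injective
  rw [Complex.ofReal_sum, ← h, Complex.ofReal_pow]
  rfl

theorem gapForm_sum (hv : Orthonormal ℂ v) (c : ι → ℂ) (s : Finset ι) :
    gapForm α β γ (∑ n ∈ s, c n • v n) (∑ n ∈ s, (c n * lam n) • v n) =
      ∑ n ∈ s, (α * lam n ^ 2 - β * lam n + γ) * ‖c n‖ ^ 2 := by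
  have h : (inner ℂ (∑ n ∈ s, (c n * lam n) • v n) (∑ n ∈ s, c n • v n) : ℂ).re =
      ∑ n ∈ s, lam n * ‖c n‖ ^ 2 := by
    rw [hv.inner_sum, Complex.re_sum]
    refine Finset.sum_congr rfl fun n _ => ?_
    have : (starRingEnd ℂ) (c n * lam n) * c n = ((lam n * ‖c n‖ ^ 2 : ℝ) : ℂ) := by
      rw [map_mul, Complex.conj_ofReal, Complex.ofReal_mul, ← Complex.normSq_eq_norm_sq,
        ← Complex.mul_conj]
      ring
    rw [this, Complex.ofReal_re]
  rw [gapForm, norm_sum_smul_sq hv, norm_sum_smul_sq hv, h, Finset.mul_sum, Finset.mul_sum,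
    Finset.mul_sum, ← Finset.sum_sub_distrib, ← Finset.sum_add_distrib]
  refine Finset.sum_congr rfl fun n _ => ?_
  rw [norm_mul, Complex.norm_real, mul_pow, Real.norm_eq_abs, sq_abs]
  ring

/-- A vanishing combination of the v_n - λ_n R v_n says x = R y for x = ∑ c_n v_n and y = ∑ c_n λ_n
v_n. The form at (x, y) is then nonnegative, yet it is a sum of negative multiples of the ‖c_n‖². -/
theorem linearIndependent_sub_smul (hS : Separates R lam α β γ) (hv : Orthonormal ℂ v) :
    LinearIndependent ℂ fun n => v n - (lam n : ℂ) • R (v n) := by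
  rw [linearIndependent_iff']
  intro s c hc n hn
  have hx : ∑ n ∈ s, c n • v n = R (∑ n ∈ s, (c n * lam n) • v n) := by
    rw [map_sum, ← sub_eq_zero, ← Finset.sum_sub_distrib, ← hc]
    refine Finset.sum_congr rfl fun k _ => ?_
    rw [map_smul, smul_sub, smul_smul]
  have h1 := hS.form_nonneg (∑ n ∈ s, (c n * lam n) • v n)
  rw [← hx, gapForm_sum hv] at h1
  have h2 : ∀ k ∈ s, (α * lam k ^ 2 - β * lam k + γ) * ‖c k‖ ^ 2 ≤ 0 := fun k _ =>
    mul_nonpos_of_nonpos_of_nonneg (hS.lam_neg k).le (sq_nonneg _)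
  have h3 := (Finset.sum_eq_zero_iff_of_nonpos h2).1 (le_antisymm (Finset.sum_nonpos h2) h1) n hn
  simpa [(hS.lam_neg n).ne] using h3

theorem continuous_gapForm : Continuous fun p : H × H => gapForm α β γ p.1 p.2 := by
  unfold gapForm
  fun_prop

theorem exists_norm_le_of_gapForm_nonneg (hα : 0 ≤ α) (hγ : γ < 0) :
    ∃ C : ℝ, 0 ≤ C ∧ ∀ x y : H, 0 ≤ gapForm α β γ x y → ‖x‖ ≤ C * ‖y‖ := by
  have hC : 0 ≤ (α + |β|) / (-γ) := by have := abs_nonneg β; exact div_nonneg (by linarith) (by linarith)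
  refine ⟨1 + (α + |β|) / (-γ), by linarith, fun x y h => ?_⟩
  -- For ‖x‖ ≤ ‖y‖ the summand 1 of the constant suffices; otherwise ‖y‖² ≤ ‖y‖ ‖x‖ and one factor
  -- ‖x‖ cancels.
  rcases le_or_gt ‖x‖ ‖y‖ with hxy | hxy
  · nlinarith [norm_nonneg y]
  have h1 : |β * (inner ℂ y x : ℂ).re| ≤ |β| * (‖y‖ * ‖x‖) := by
    rw [abs_mul]
    exact mul_le_mul_of_nonneg_left ((Complex.abs_re_le_norm _).trans (norm_inner_le_norm y x))
      (abs_nonneg _)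
  have h2 := neg_le_of_abs_le h1
  have h3 : -γ * ‖x‖ ^ 2 ≤ (α + |β|) * ‖y‖ * ‖x‖ := by
    have : α * ‖y‖ ^ 2 ≤ α * (‖y‖ * ‖x‖) :=
      mul_le_mul_of_nonneg_left (by nlinarith [norm_nonneg y]) hα
    unfold gapForm at h
    linarith
  have hx : 0 < ‖x‖ := (norm_nonneg y).trans_lt hxy
  have h4 : -γ * ‖x‖ ≤ (α + |β|) * ‖y‖ := by
    refine le_of_mul_le_mul_right ?_ hx
    linarith
  have h5 : ‖x‖ ≤ (α + |β|) / (-γ) * ‖y‖ := by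
    rw [div_mul_eq_mul_div, le_div_iff₀ (by linarith)]
    linarith
  linarith [norm_nonneg y]

theorem gapForm_eq_add (V : Submodule ℂ H) [V.HasOrthogonalProjection] (x y : H) :
    gapForm α β γ x y = gapForm α β γ (V.starProjection x) (V.starProjection y) +
      gapForm α β γ (x - V.starProjection x) (y - V.starProjection y) := by
  have hn : ∀ z : H, ‖z‖ ^ 2 = ‖V.starProjection z‖ ^ 2 + ‖z - V.starProjection z‖ ^ 2 := fun z => by
    have := V.norm_sq_eq_add_norm_sq_starProjection (x := z)
    rwa [Submodule.starProjection_orthogonal_val] at this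
  have h1 : inner ℂ (V.starProjection y) (x - V.starProjection x) = 0 :=
    Submodule.inner_right_of_mem_orthogonal (V.starProjection_apply_mem y)
      (V.sub_starProjection_mem_orthogonal x)
  have h2 : inner ℂ (y - V.starProjection y) (V.starProjection x) = 0 :=
    V.starProjection_inner_eq_zero _ _ (V.starProjection_apply_mem x)
  have hi : inner ℂ y x = inner ℂ (V.starProjection y) (V.starProjection x) +
      inner ℂ (y - V.starProjection y) (x - V.starProjection x) := by
    rw [inner_sub_right, h2, inner_sub_left] at *
    rw [sub_eq_zero] at h1
    rw [h1]
    ring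
  unfold gapForm
  rw [hn x, hn y, hi, Complex.add_re]
  ring

variable [CompleteSpace H]

theorem hasSum_starProjection_prod (hv : Orthonormal ℂ v) {g k : H}
    (hgk : ∀ n, lam n * inner ℂ (v n) g = inner ℂ (v n) k) :
    HasSum (fun n => inner ℂ (v n) g • (v n, (lam n : ℂ) • v n))
      ((closedSpan v).starProjection g, (closedSpan v).starProjection k) := by
  have h := (hasSum_inner_smul_starProjection hv g).prodMk (hasSum_inner_smul_starProjection hv k)
  convert h using 1
  funext n
  rw [← hgk, Prod.smul_mk, smul_smul, mul_comm]

/-- The projected pair is a limit of finite combinations of the (v_n, λ_n v_n), on which the form is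
diagonal with negative coefficients. -/
theorem gapForm_starProjection_nonpos (hS : Separates R lam α β γ) (hv : Orthonormal ℂ v) {g k : H}
    (hgk : ∀ n, lam n * inner ℂ (v n) g = inner ℂ (v n) k) :
    gapForm α β γ ((closedSpan v).starProjection g) ((closedSpan v).starProjection k) ≤ 0 := by
  have ht : Filter.Tendsto (fun s : Finset ι =>
      ∑ n ∈ s, inner ℂ (v n) g • (v n, (lam n : ℂ) • v n)) Filter.atTop
      (nhds ((closedSpan v).starProjection g, (closedSpan v).starProjection k)) :=
    hasSum_starProjection_prod hv hgk
  have hs : ∀ s : Finset ι, gapForm α β γ (∑ n ∈ s, inner ℂ (v n) g • (v n, (lam n : ℂ) • v n)).1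
      (∑ n ∈ s, inner ℂ (v n) g • (v n, (lam n : ℂ) • v n)).2 ≤ 0 := fun s => by
    rw [Prod.fst_sum, Prod.snd_sum]
    simp only [Prod.smul_fst, Prod.smul_snd, smul_smul]
    rw [gapForm_sum hv]
    exact Finset.sum_nonpos fun k _ =>
      mul_nonpos_of_nonpos_of_nonneg (hS.lam_neg k).le (sq_nonneg _)
  have h := (continuous_gapForm (α := α) (β := β) (γ := γ)).tendsto
    ((closedSpan v).starProjection g, (closedSpan v).starProjection k) |>.comp ht
  exact le_of_tendsto h (Filter.Eventually.of_forall hs)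

end Form

/-! ### The operator T_0, its extension by zero, and self-adjointness -/

section Core

variable {ι : Type*} {v : ι → H} {lam : ι → ℝ} {R : H →L[ℂ] H} {α β γ : ℝ}

/-- The vectors `v_n - λ_n R v_n`. -/
def shifted (R : H →L[ℂ] H) (lam : ι → ℝ) (v : ι → H) (n : ι) : H := v n - (lam n : ℂ) • R (v n)

variable (U : Submodule ℂ H) [U.HasOrthogonalProjection]

/-- The map `(x, y) ↦ (P (x - R y), P y)`, where `P` is the projection onto `U`. -/
def compress (R : H →L[ℂ] H) : H × H →L[ℂ] U × U :=
  (U.orthogonalProjectionOnto ∘L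
    (ContinuousLinearMap.fst ℂ H H - R ∘L ContinuousLinearMap.snd ℂ H H)).prod
    (U.orthogonalProjectionOnto ∘L ContinuousLinearMap.snd ℂ H H)

@[simp] theorem compress_fst (R : H →L[ℂ] H) (p : H × H) :
    (compress U R p).1 = U.orthogonalProjectionOnto (p.1 - R p.2) := rfl

@[simp] theorem compress_snd (R : H →L[ℂ] H) (p : H × H) :
    (compress U R p).2 = U.orthogonalProjectionOnto p.2 := rfl

/-- The span of the pairs `(P u_n, P (λ_n v_n))`. -/
def core (R : H →L[ℂ] H) (lam : ι → ℝ) (v : ι → H) : Submodule ℂ (U × U) :=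
  Submodule.span ℂ (Set.range fun n => compress U R (v n, (lam n : ℂ) • v n))

/-- The sum of `core` and the zero operator on the vectors orthogonal to all `v_n`. -/
def extCore (R : H →L[ℂ] H) (lam : ι → ℝ) (v : ι → H) : Submodule ℂ (U × U) :=
  Submodule.span ℂ (Set.range (fun n => compress U R (v n, (lam n : ℂ) • v n)) ∪
    {p | p.2 = 0 ∧ ∀ n, inner ℂ (v n) (p.1 : H) = 0})

theorem core_le_extCore : core U R lam v ≤ extCore U R lam v :=
  Submodule.span_mono Set.subset_union_left

variable {U}

theorem coe_orthogonalProjectionOnto_of_mem {x : H} (hx : x ∈ U) :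
    (U.orthogonalProjectionOnto x : H) = x :=
  congrArg Subtype.val (U.orthogonalProjectionOnto_mem_subspace_eq_self ⟨x, hx⟩)

theorem inner_orthogonalProjectionOnto_right (z : U) (x : H) :
    inner ℂ z (U.orthogonalProjectionOnto x) = inner ℂ (z : H) x :=
  Submodule.inner_orthogonalProjectionOnto_eq_of_mem_left z x

theorem inner_orthogonalProjectionOnto_left (x : H) (z : U) :
    inner ℂ (U.orthogonalProjectionOnto x) z = inner ℂ x (z : H) :=
  Submodule.inner_orthogonalProjectionOnto_eq_of_mem_right z x

theorem coe_compress_fst (hu : ∀ n, shifted R lam v n ∈ U) (n : ι) :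
    ((compress U R (v n, (lam n : ℂ) • v n)).1 : H) = shifted R lam v n := by
  rw [compress_fst, map_smul]
  exact coe_orthogonalProjectionOnto_of_mem (hu n)

theorem inner_shifted_left (hR : ∀ x y, inner ℂ (R x) y = inner ℂ x (R y)) (n : ι) (x : H) :
    inner ℂ (shifted R lam v n) x = inner ℂ (v n) x - lam n * inner ℂ (v n) (R x) := by
  rw [shifted, inner_sub_left, inner_smul_left, hR, Complex.conj_ofReal]

theorem extCore_le_adjoint (hR : ∀ x y, inner ℂ (R x) y = inner ℂ x (R y)) (hv : Orthonormal ℂ v)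
    (hu : ∀ n, shifted R lam v n ∈ U) : extCore U R lam v ≤ (extCore U R lam v).adjoint := by
  rw [extCore, Submodule.span_le]
  have hvv : ∀ m n, (lam m : ℂ) * inner ℂ (v m) (v n) = lam n * inner ℂ (v m) (v n) := by
    intro m n
    by_cases hmn : m = n
    · rw [hmn]
    · rw [hv.2 hmn, mul_zero, mul_zero]
  rintro p hp
  rw [SetLike.mem_coe, mem_adjoint_span]
  rintro q hq
  rcases hp with ⟨n, rfl⟩ | ⟨hp0, hpn⟩ <;> rcases hq with ⟨m, rfl⟩ | ⟨hq0, hqn⟩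
  · rw [compress_snd, inner_orthogonalProjectionOnto_left, coe_compress_fst hu, compress_snd,
      inner_orthogonalProjectionOnto_right, coe_compress_fst hu, inner_shifted_left hR, shifted]
    simp only [inner_smul_left, inner_sub_right, inner_smul_right, map_smul, Complex.conj_ofReal]
    linear_combination hvv m n
  · rw [hq0, inner_zero_left, compress_snd, inner_orthogonalProjectionOnto_right, inner_smul_right,
      ← inner_conj_symm, hqn, map_zero, mul_zero]
  · rw [hp0, inner_zero_right, compress_snd, inner_orthogonalProjectionOnto_left, inner_smul_left,
      hpn, mul_zero]
  · rw [hp0, hq0, inner_zero_left, inner_zero_right]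

/-- Testing against the two kinds of generators: the first makes (h + R k, k) behave like a pair of
the extension sought, the second makes k orthogonal to U ∩ Vᗮ. -/
theorem of_mem_adjoint_extCore (hR : ∀ x y, inner ℂ (R x) y = inner ℂ x (R y))
    (hu : ∀ n, shifted R lam v n ∈ U) {p : U × U} (hp : p ∈ (extCore U R lam v).adjoint) :
    (∀ n, lam n * inner ℂ (v n) ((p.1 : H) + R p.2) = inner ℂ (v n) (p.2 : H)) ∧
    ∀ w ∈ U, (∀ n, inner ℂ (v n) w = 0) → inner ℂ w (p.2 : H) = 0 := by
  rw [extCore, mem_adjoint_span] at hp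
  constructor
  · intro n
    have h := hp _ (Or.inl ⟨n, rfl⟩)
    simp only at h
    rw [compress_snd, inner_orthogonalProjectionOnto_left, Submodule.coe_inner,
      coe_compress_fst hu, inner_shifted_left hR] at h
    simp only [inner_smul_left, Complex.conj_ofReal] at h
    rw [inner_add_right]
    linear_combination h
  · intro w hw hwn
    have h := hp (⟨w, hw⟩, 0) (Or.inr ⟨rfl, hwn⟩)
    rw [inner_zero_left] at h
    exact h.symm

theorem dense_map_fst_core (hU : U ≤ closedSpan (shifted R lam v))
    (hu : ∀ n, shifted R lam v n ∈ U) :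
    Dense ((core U R lam v).map (LinearMap.fst ℂ U U) : Set U) := by
  have hsub : Submodule.span ℂ (Set.range (shifted R lam v)) ≤
      ((core U R lam v).map (LinearMap.fst ℂ U U)).map U.subtype := by
    rw [Submodule.span_le]
    rintro _ ⟨n, rfl⟩
    exact ⟨_, ⟨_, Submodule.subset_span ⟨n, rfl⟩, rfl⟩, coe_compress_fst hu n⟩
  intro x
  rw [closure_subtype]
  exact closure_mono hsub (hU x.2)

variable [CompleteSpace H]

theorem compress_mem_closure_core (hv : Orthonormal ℂ v) {g k : H}
    (hgk : ∀ n, lam n * inner ℂ (v n) g = inner ℂ (v n) k) :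
    compress U R ((closedSpan v).starProjection g, (closedSpan v).starProjection k) ∈
      (core U R lam v).topologicalClosure := by
  have h := (hasSum_starProjection_prod hv hgk).mapL (compress U R)
  refine mem_closure_of_tendsto h (Filter.Eventually.of_forall fun s => ?_)
  refine Submodule.sum_mem _ fun n _ => ?_
  rw [map_smul]
  exact Submodule.smul_mem _ _ (Submodule.subset_span ⟨n, rfl⟩)

theorem starProjection_sub_mem (hv : Orthonormal ℂ v) (hu : ∀ n, shifted R lam v n ∈ U) {g k : H}
    (hgk : ∀ n, lam n * inner ℂ (v n) g = inner ℂ (v n) k) :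
    (closedSpan v).starProjection g - R ((closedSpan v).starProjection k) ∈ U := by
  have h := (hasSum_starProjection_prod hv hgk).mapL
    (ContinuousLinearMap.fst ℂ H H - R ∘L ContinuousLinearMap.snd ℂ H H)
  rw [← U.orthogonal_orthogonal] at hu ⊢
  refine (Submodule.isClosed_orthogonal Uᗮ).mem_of_tendsto h
    (Filter.Eventually.of_forall fun s => Submodule.sum_mem _ fun n _ => ?_)
  rw [map_smul]
  refine Submodule.smul_mem _ _ ?_
  simpa [shifted] using hu n

/-- With g = h + R k, the pair (h, k) is the compression of (g, k), and (g, k) is split along V and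
Vᗮ. The V-part lies in the closure of the core. For the Vᗮ-part, k is approximated through Uᗮ: for p
in Uᗮ, (R p, p) compresses to 0, so its Vᗮ-part compresses to minus its V-part, again in the
closure. What remains has second entry 0 and belongs to the added zero operator. -/
theorem adjoint_extCore_le (hR : ∀ x y, inner ℂ (R x) y = inner ℂ x (R y))
    (hS : Separates R lam α β γ) (hv : Orthonormal ℂ v) (hu : ∀ n, shifted R lam v n ∈ U) :
    (extCore U R lam v).adjoint ≤ (extCore U R lam v).topologicalClosure := by
  set V := closedSpan v
  set Q : H →L[ℂ] H := ContinuousLinearMap.id ℂ H - V.starProjection with hQ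
  have hQa : ∀ x, Q x = x - V.starProjection x := fun x => rfl
  have hQV : ∀ x, Q x ∈ Vᗮ := fun x => V.sub_starProjection_mem_orthogonal x
  have hQs : ∀ x y, inner ℂ (Q x) y = inner ℂ x (Q y) := fun x y => by
    rw [hQa, hQa, inner_sub_left, inner_sub_right, V.inner_starProjection_left_eq_right]
  have hQQ : ∀ x ∈ Vᗮ, Q x = x := fun x hx => by
    rw [hQa, (V.starProjection_apply_eq_zero_iff).2 hx, sub_zero]
  rintro ⟨h, k⟩ hp
  obtain ⟨hg, hw⟩ := of_mem_adjoint_extCore hR hu hp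
  simp only at hg hw
  have hcl := (core U R lam v).topologicalClosure_mono (core_le_extCore U)
  have hmem1 := hcl (compress_mem_closure_core (U := U) (R := R) hv hg)
  -- the vectors orthogonal to `U`
  have hUp : ∀ p ∈ Uᗮ, ∀ n, lam n * inner ℂ (v n) (R p) = inner ℂ (v n) p := fun p hp n => by
    have := Submodule.inner_right_of_mem_orthogonal (hu n) hp
    rw [inner_shifted_left hR] at this
    linear_combination -this
  have hmem2 : ∀ p ∈ Uᗮ, compress U R (Q (R p), Q p) ∈ (extCore U R lam v).topologicalClosure := by
    intro p hp
    have h1 := hcl (compress_mem_closure_core (U := U) (R := R) hv (hUp p hp))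
    have h2 : compress U R (R p, p) = 0 := by
      have : U.orthogonalProjectionOnto p = 0 :=
        U.orthogonalProjectionOnto_eq_zero_iff.2 hp
      ext <;> simp [this]
    have h3 : compress U R (Q (R p), Q p) =
        compress U R (R p, p) - compress U R (V.starProjection (R p), V.starProjection p) := by
      rw [← map_sub]; rfl
    rw [h3, h2, zero_sub]
    exact Submodule.neg_mem _ h1
  obtain ⟨C, hC0, hC⟩ := exists_norm_le_of_gapForm_nonneg (H := H) (β := β) hS.nonneg hS.neg
  -- The form is nonnegative at (R p, p) and nonpositive on the V-part, hence nonnegative on the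
  -- Vᗮ-part. This bound turns convergence of Q p_j into convergence of Q R p_j.
  have hbound : ∀ p ∈ Uᗮ, ‖Q (R p)‖ ≤ C * ‖Q p‖ := by
    intro p hp
    refine hC _ _ ?_
    have h1 := hS.form_nonneg p
    rw [gapForm_eq_add V] at h1
    have h2 := gapForm_starProjection_nonpos hS hv (hUp p hp)
    rw [hQa, hQa]
    linarith
  -- approximation of `Q k`
  have hk : Q k ∈ closure ((Uᗮ).map (Q : H →ₗ[ℂ] H) : Set H) := by
    rw [← Submodule.topologicalClosure_coe, ← Submodule.orthogonal_orthogonal_eq_closure,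
      SetLike.mem_coe, Submodule.mem_orthogonal]
    intro z hz
    -- A vector z orthogonal to Q(Uᗮ) has Q z in U ∩ Vᗮ, to which k is orthogonal by `hw`.
    have hzU : Q z ∈ U := by
      rw [← U.orthogonal_orthogonal, Submodule.mem_orthogonal]
      intro p hp
      rw [← hQs]
      exact (Submodule.mem_orthogonal _ _).1 hz _ ⟨p, hp, rfl⟩
    rw [← hQs]
    exact hw _ hzU (mem_closedSpan_orthogonal.1 (hQV z))
  obtain ⟨y, hy, hylim⟩ := mem_closure_iff_seq_limit.1 hk
  choose p hpU hpy using hy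
  have hpy' : ∀ j, Q (p j) = y j := hpy
  have hcau : CauchySeq fun j => Q (R (p j)) := by
    rw [Metric.cauchySeq_iff]
    intro ε hε
    obtain ⟨N, hN⟩ := Metric.cauchySeq_iff.1 hylim.cauchySeq (ε / (C + 1)) (by positivity)
    refine ⟨N, fun m hm n hn => ?_⟩
    have h1 := hN m hm n hn
    have h2 := hbound (p m - p n) (sub_mem (hpU m) (hpU n))
    rw [map_sub, map_sub, map_sub, hpy', hpy'] at h2
    rw [dist_eq_norm] at h1 ⊢
    rw [lt_div_iff₀ (by positivity)] at h1
    nlinarith [norm_nonneg (y m - y n)]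
  obtain ⟨s, hs⟩ := cauchySeq_tendsto_of_complete hcau
  have hsV : s ∈ Vᗮ := (Submodule.isClosed_orthogonal V).mem_of_tendsto hs
    (Filter.Eventually.of_forall fun j => hQV _)
  have hmem3 : compress U R (s, Q k) ∈ (extCore U R lam v).topologicalClosure := by
    refine (Submodule.isClosed_topologicalClosure _).mem_of_tendsto
      (((compress U R).continuous.tendsto _).comp (hs.prodMk_nhds hylim))
      (Filter.Eventually.of_forall fun j => ?_)
    rw [Function.comp_apply, ← hpy']
    exact hmem2 _ (hpU j)
  have hsU : s - R (Q k) ∈ U := by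
    have hUc : IsClosed (U : Set H) := by
      rw [← U.orthogonal_orthogonal]
      exact Submodule.isClosed_orthogonal _
    refine hUc.mem_of_tendsto (hs.sub ((R.continuous.tendsto _).comp hylim))
      (Filter.Eventually.of_forall fun j => ?_)
    have h1 := starProjection_sub_mem hv hu (hUp (p j) (hpU j))
    have h2 : Q (R (p j)) - R (Q (p j)) =
        -(V.starProjection (R (p j)) - R (V.starProjection (p j))) := by
      rw [hQa, hQa, map_sub]
      abel
    rw [Function.comp_apply, ← hpy', SetLike.mem_coe, h2]
    exact Submodule.neg_mem _ h1
  have hyU : Q (h + R k) - R (Q k) ∈ U := by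
    have h1 := starProjection_sub_mem hv hu hg
    have h2 : Q (h + R k) - R (Q k) =
        h - (V.starProjection (h + R k) - R (V.starProjection k)) := by
      rw [hQa, hQa, map_sub]
      abel
    rw [h2]
    exact sub_mem h.2 h1
  -- Both Q g - R Q k and s - R Q k lie in U, so their difference Q g - s lies in U ∩ Vᗮ.
  have hmem4 : compress U R (Q (h + R k) - s, 0) ∈ (extCore U R lam v).topologicalClosure := by
    refine Submodule.le_topologicalClosure _ (Submodule.subset_span (Or.inr ⟨by simp, fun n => ?_⟩))
    have h1 : Q (h + R k) - s ∈ U := by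
      have := sub_mem hyU hsU
      rwa [sub_sub_sub_cancel_right] at this
    have h2 : Q (h + R k) - s ∈ Vᗮ := sub_mem (hQV _) hsV
    rw [compress_fst, map_zero, sub_zero, coe_orthogonalProjectionOnto_of_mem h1]
    exact mem_closedSpan_orthogonal.1 h2 n
  have hsum : ((h, k) : U × U) =
      compress U R (V.starProjection (h + R k), V.starProjection k) +
        compress U R (s, Q k) + compress U R (Q (h + R k) - s, 0) := by
    rw [← map_add, ← map_add]
    have : (V.starProjection (h + R k), V.starProjection k) + (s, Q k) +
        (Q (h + R k) - s, 0) = ((h : H) + R k, (k : H)) := by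
      ext <;> simp [hQa]
    rw [this]
    ext <;> simp
  rw [hsum]
  exact add_mem (add_mem hmem1 hmem3) hmem4

theorem adjoint_extCore_eq (hR : ∀ x y, inner ℂ (R x) y = inner ℂ x (R y))
    (hS : Separates R lam α β γ) (hv : Orthonormal ℂ v) (hu : ∀ n, shifted R lam v n ∈ U) :
    (extCore U R lam v).adjoint = (extCore U R lam v).topologicalClosure :=
  le_antisymm (adjoint_extCore_le hR hS hv hu) <|
    Submodule.topologicalClosure_minimal _ (extCore_le_adjoint hR hv hu) (isClosed_adjoint _)

omit [CompleteSpace H] in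
-- Let w be in U ∩ Vᗮ and approximate it by u = x - R y, with x in the span of the v_n and y its
-- image under v_n ↦ λ_n v_n. The form is at most -ε‖x‖² at (x, y) and nonnegative at (x - u, y). In
-- the difference the cross terms see only u - w, since w is orthogonal to x and y. Thus ‖u‖² is
-- bounded by a multiple of ‖u - w‖², and u → w gives w = 0.
theorem extCore_eq_core (hv : Orthonormal ℂ v) (hS : Separates R lam α β γ)
    (hU : U ≤ closedSpan (shifted R lam v)) {ε M : ℝ} (hε : 0 < ε) (hM : ∀ n, |lam n| ≤ M)
    (hlam : ∀ n, α * lam n ^ 2 - β * lam n + γ ≤ -ε) :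
    extCore U R lam v = core U R lam v := by
  refine le_antisymm ?_ (core_le_extCore U)
  rw [extCore, Submodule.span_le]
  rintro p (hp | ⟨hp0, hpn⟩)
  · exact Submodule.subset_span hp
  suffices hp1 : (p.1 : H) = 0 by
    have : p = 0 := Prod.ext (Subtype.ext hp1) hp0
    rw [this]
    exact zero_mem _
  set w : H := (p.1 : H)
  have hγ := hS.neg
  set K := |β| * |M| - 2 * γ with hK
  have key : ∀ u ∈ Submodule.span ℂ (Set.range (shifted R lam v)),
      -γ * ‖u‖ ^ 2 ≤ K ^ 2 / (4 * ε) * ‖u - w‖ ^ 2 := by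
    intro u hu
    obtain ⟨c, rfl⟩ := Finsupp.mem_span_range_iff_exists_finsupp.1 hu
    set s := c.support
    set x := ∑ n ∈ s, c n • v n with hx
    set y := ∑ n ∈ s, (c n * lam n) • v n with hy
    have hu' : (c.sum fun i a => a • shifted R lam v i) = x - R y := by
      rw [Finsupp.sum, hx, hy, map_sum, ← Finset.sum_sub_distrib]
      refine Finset.sum_congr rfl fun n _ => ?_
      rw [shifted, smul_sub, smul_smul, map_smul]
    rw [hu']
    set u := x - R y with hud
    have hRy : R y = x - u := by rw [hud]; abel
    have h1 := hS.form_nonneg y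
    rw [hRy] at h1
    have h2 : gapForm α β γ x y ≤ -ε * ‖x‖ ^ 2 := by
      rw [hx, hy, gapForm_sum hv, norm_sum_smul_sq hv, Finset.mul_sum]
      exact Finset.sum_le_sum fun n _ => mul_le_mul_of_nonneg_right (hlam n) (sq_nonneg _)
    have hyx : ‖y‖ ≤ |M| * ‖x‖ := by
      refine le_of_sq_le_sq ?_ (by positivity)
      rw [mul_pow, hx, hy, norm_sum_smul_sq hv, norm_sum_smul_sq hv, Finset.mul_sum]
      refine Finset.sum_le_sum fun n _ => ?_
      rw [norm_mul, mul_pow, mul_comm, Complex.norm_real, Real.norm_eq_abs]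
      exact mul_le_mul_of_nonneg_right
        (pow_le_pow_left₀ (abs_nonneg _) ((hM n).trans (le_abs_self M)) 2) (sq_nonneg _)
    have horth : ∀ d : ι → ℂ, inner ℂ (∑ n ∈ s, d n • v n) w = 0 := fun d => by
      rw [sum_inner]
      exact Finset.sum_eq_zero fun n _ => by rw [inner_smul_left, hpn, mul_zero]
    have h3 : (inner ℂ y u : ℂ).re = (inner ℂ y (u - w) : ℂ).re := by
      rw [inner_sub_right y u w, show inner ℂ y w = 0 from horth _, sub_zero]
    have h4 : (inner ℂ x u : ℂ).re = (inner ℂ x (u - w) : ℂ).re := by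
      rw [inner_sub_right x u w, show inner ℂ x w = 0 from horth _, sub_zero]
    have h5 : |(inner ℂ y (u - w) : ℂ).re| ≤ |M| * ‖x‖ * ‖u - w‖ :=
      ((Complex.abs_re_le_norm _).trans (norm_inner_le_norm _ _)).trans
        (mul_le_mul_of_nonneg_right hyx (norm_nonneg _))
    have h6 : (inner ℂ x (u - w) : ℂ).re ≤ ‖x‖ * ‖u - w‖ :=
      (Complex.re_le_norm _).trans (norm_inner_le_norm _ _)
    have h7 : ‖x - u‖ ^ 2 = ‖x‖ ^ 2 - 2 * (inner ℂ x u : ℂ).re + ‖u‖ ^ 2 :=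
      norm_sub_sq (𝕜 := ℂ) x u
    have h8 : β * (inner ℂ y (u - w) : ℂ).re ≤ |β| * (|M| * ‖x‖ * ‖u - w‖) := by
      refine (le_abs_self _).trans ?_
      rw [abs_mul]
      exact mul_le_mul_of_nonneg_left h5 (abs_nonneg _)
    have h9 : -2 * γ * (inner ℂ x (u - w) : ℂ).re ≤ -2 * γ * (‖x‖ * ‖u - w‖) :=
      mul_le_mul_of_nonneg_left h6 (by linarith)
    have h10 : -γ * ‖u‖ ^ 2 ≤ -ε * ‖x‖ ^ 2 + K * ‖x‖ * ‖u - w‖ := by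
      unfold gapForm at h1 h2
      rw [h7, inner_sub_right, Complex.sub_re, h3, h4] at h1
      rw [hK]
      linarith
    refine h10.trans ?_
    -- Completing the square removes ‖x‖, which is not controlled as u tends to w.
    have h11 : 0 ≤ (2 * ε * ‖x‖ - K * ‖u - w‖) ^ 2 / (4 * ε) := by positivity
    have h12 : (2 * ε * ‖x‖ - K * ‖u - w‖) ^ 2 / (4 * ε) =
        ε * ‖x‖ ^ 2 - K * ‖x‖ * ‖u - w‖ + K ^ 2 / (4 * ε) * ‖u - w‖ ^ 2 := by
      field_simp
      ring
    linarith
  have hc : IsClosed {u : H | -γ * ‖u‖ ^ 2 ≤ K ^ 2 / (4 * ε) * ‖u - w‖ ^ 2} :=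
    isClosed_le (by fun_prop) (by fun_prop)
  have h1 : -γ * ‖w‖ ^ 2 ≤ K ^ 2 / (4 * ε) * ‖w - w‖ ^ 2 :=
    closure_minimal (show ((Submodule.span ℂ (Set.range (shifted R lam v)) : Submodule ℂ H) : Set H)
      ⊆ _ from key) hc (hU p.1.2)
  rw [sub_self, norm_zero] at h1
  have h2 : ‖w‖ ^ 2 ≤ 0 := by
    by_contra! h
    nlinarith
  exact norm_eq_zero.1 (pow_eq_zero_iff two_ne_zero |>.1 (le_antisymm h2 (sq_nonneg _)))

end Core

/-! ### Resolvent bounds and positivity of the form -/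

section Resolvent

variable {D : H →ₗ.[ℂ] H} {z : ℂ} {R : H →L[ℂ] H}

theorem IsBoundedInverse.mem_graph (hR : IsBoundedInverse D z R) (x : H) :
    (R x, x + z • R x) ∈ D.graph := by
  obtain ⟨h, hx⟩ := hR.1 x
  rw [LinearPMap.mem_graph_iff]
  exact ⟨⟨R x, h⟩, rfl, eq_add_of_sub_eq hx⟩

theorem IsBoundedInverse.apply_of_mem_graph (hR : IsBoundedInverse D z R) {g k : H}
    (h : (g, k) ∈ D.graph) : R (k - z • g) = g := by
  obtain ⟨x, rfl, rfl⟩ := LinearPMap.mem_graph_iff _ |>.1 h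
  exact hR.2 x

theorem isBoundedInverse_boundedInverse (h : InResolventSet D 0) :
    IsBoundedInverse D 0 (boundedInverse D) := by
  rw [boundedInverse, dif_pos h]
  exact h.choose_spec

theorem mem_eigenspace_iff {A : H →ₗ.[ℂ] H} {x : H} :
    x ∈ eigenspace A z ↔ (x, z • x) ∈ A.graph := by
  rw [eigenspace, LinearPMap.mem_graph_iff, Submodule.mem_map]
  constructor
  · rintro ⟨y, hy, rfl⟩
    exact ⟨y, rfl, sub_eq_zero.1 hy⟩
  · rintro ⟨y, rfl, hy⟩
    exact ⟨y, sub_eq_zero.2 hy, rfl⟩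

variable [CompleteSpace H]

theorem inner_symm_of_mem_graph (hD : IsSelfAdjoint D) {p q : H × H} (hp : p ∈ D.graph)
    (hq : q ∈ D.graph) : inner ℂ q.2 p.1 = inner ℂ q.1 p.2 := by
  rw [← graph_adjoint_eq_of_isSelfAdjoint hD] at hp
  exact (mem_adjoint_iff_inner_eq _ _).1 hp q hq

theorem IsBoundedInverse.inner_symm (hD : IsSelfAdjoint D) {c : ℝ}
    (hR : IsBoundedInverse D (c : ℂ) R) (x y : H) : inner ℂ (R x) y = inner ℂ x (R y) := by
  have := inner_symm_of_mem_graph hD (hR.mem_graph y) (hR.mem_graph x)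
  simp only [inner_add_left, inner_add_right, inner_smul_left, inner_smul_right,
    Complex.conj_ofReal] at this
  linear_combination -this

/-- R is self-adjoint, so its norm is its spectral radius. A spectral value μ with |μ| > 1/r would
put c + 1/μ in the resolvent set of D, and the resolvent there yields an inverse of μ - R. -/
theorem IsBoundedInverse.norm_le (hD : IsSelfAdjoint D) {c r : ℝ} (hr : 0 < r)
    (hR : IsBoundedInverse D (c : ℂ) R)
    (hres : ∀ x, c - r < x → x < c + r → InResolventSet D ((x : ℝ) : ℂ)) : ‖R‖ ≤ r⁻¹ := by
  have hsa : IsSelfAdjoint R :=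
    ContinuousLinearMap.isSelfAdjoint_iff_isSymmetric.2 fun x y => hR.inner_symm hD x y
  have hs := hsa.spectralRadius_eq_nnnorm
  have hle : spectralRadius ℂ R ≤ Real.toNNReal r⁻¹ := by
    refine iSup₂_le fun z hz => ?_
    rw [ENNReal.coe_le_coe, ← NNReal.coe_le_coe, coe_nnnorm,
      Real.coe_toNNReal _ (inv_pos.2 hr).le]
    by_contra! hlt
    have hre := hsa.mem_spectrum_eq_re hz
    set μ := z.re
    rw [hre, Complex.norm_real, Real.norm_eq_abs] at hlt
    have hμ : μ ≠ 0 := by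
      rintro h0
      rw [h0, abs_zero] at hlt
      exact absurd hlt (inv_pos.2 hr).le.not_gt
    have ht : |μ⁻¹| < r := by
      rw [abs_inv]
      exact inv_lt_of_inv_lt₀ hr hlt
    obtain ⟨ht1, ht2⟩ := abs_lt.1 ht
    obtain ⟨R', hR'⟩ := hres (c + μ⁻¹) (by linarith) (by linarith)
    have hμt : (μ : ℂ) * ((μ⁻¹ : ℝ) : ℂ) = 1 := by
      rw [← Complex.ofReal_mul, mul_inv_cancel₀ hμ, Complex.ofReal_one]
    set t : ℂ := ((μ⁻¹ : ℝ) : ℂ) with htd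
    have h1 : ∀ x, R' x = R x + t • R (R' x) := fun x => by
      have := hR.apply_of_mem_graph (hR'.mem_graph x)
      rw [Complex.ofReal_add, ← htd, add_smul, add_comm ((c : ℂ) • R' x), ← add_assoc,
        add_sub_cancel_right, map_add, map_smul] at this
      exact this.symm
    have h2 : ∀ x, R' x = R x + t • R' (R x) := fun x => by
      have := hR'.apply_of_mem_graph (hR.mem_graph x)
      rw [Complex.ofReal_add, ← htd, add_smul, add_comm ((c : ℂ) • R x), add_sub_add_right_eq_sub,
        map_sub, map_smul] at this
      exact eq_add_of_sub_eq this
    refine (spectrum.mem_iff.1 hz) ?_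
    rw [hre]
    -- With t = 1/μ, the resolvent identities `h1` and `h2` make t + t² R' a two-sided inverse of μ
    -- - R.
    refine isUnit_iff_exists.2 ⟨t • 1 + (t * t) • R', ?_, ?_⟩
    · ext x
      have := h1 x
      simp only [mul_apply_eq_comp, sub_apply,
        add_apply, smul_apply,
        one_apply_eq_self, Algebra.algebraMap_eq_smul_one, map_add, map_smul]
      linear_combination (norm := module) t • this + hμt • (x + t • R' x)
    · ext x
      have := h2 x
      simp only [mul_apply_eq_comp, sub_apply,
        add_apply, smul_apply,
        one_apply_eq_self, Algebra.algebraMap_eq_smul_one, map_sub, map_smul]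
      linear_combination (norm := module) t • this + hμt • (x + t • R' x)
  rw [hs, ENNReal.coe_le_coe, ← NNReal.coe_le_coe, coe_nnnorm,
    Real.coe_toNNReal _ (inv_pos.2 hr).le] at hle
  exact hle

/-- This is (D - r)(D - b) ≥ 0: the square of the bound ((b - r)/2) ‖R p‖ ≤ ‖p - ((r + b)/2) R p‖
given by the resolvent at the midpoint. -/
theorem gapForm_nonneg (hD : IsSelfAdjoint D) (hR : IsBoundedInverse D 0 R) {r b : ℝ} (hrb : r < b)
    (hres : ∀ x, r < x → x < b → InResolventSet D ((x : ℝ) : ℂ)) (p : H) :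
    0 ≤ gapForm 1 (r + b) (r * b) (R p) p := by
  obtain ⟨R', hR'⟩ := hres ((r + b) / 2) (by linarith) (by linarith)
  have hn := hR'.norm_le hD (r := (b - r) / 2) (by linarith)
    fun x h1 h2 => hres x (by linarith) (by linarith)
  have h1 := hR'.apply_of_mem_graph (hR.mem_graph p)
  rw [zero_smul, add_zero] at h1
  have h2 := R'.le_of_opNorm_le hn (p - (((r + b) / 2 : ℝ) : ℂ) • R p)
  rw [h1, inv_mul_eq_div, le_div_iff₀ (by linarith)] at h2
  have h3 : ‖p - (((r + b) / 2 : ℝ) : ℂ) • R p‖ ^ 2 =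
      ‖p‖ ^ 2 - 2 * ((r + b) / 2 * (inner ℂ p (R p) : ℂ).re) + ((r + b) / 2) ^ 2 * ‖R p‖ ^ 2 := by
    rw [norm_sub_sq (𝕜 := ℂ), norm_smul, mul_pow, Complex.norm_real, Real.norm_eq_abs, sq_abs,
      inner_smul_right, RCLike.re_eq_complex_re, Complex.re_ofReal_mul]
  have h4 := pow_le_pow_left₀ (mul_nonneg (norm_nonneg _) (by linarith)) h2 2
  rw [h3] at h4
  unfold gapForm
  linarith

theorem exists_gapForm {a : WithBot ℝ} {b : ℝ} (hD : IsSelfAdjoint D)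
    (hR : IsBoundedInverse D 0 R) (h0 : (0 : ℝ) ∈ gapInterval a b)
    (hres : ∀ x ∈ gapInterval a b, InResolventSet D (x : ℂ)) :
    ∃ α β γ : ℝ, 0 ≤ α ∧ γ < 0 ∧ (∀ p, 0 ≤ gapForm α β γ (R p) p) ∧
      ∀ x ∈ gapInterval a b, α * x ^ 2 - β * x + γ < 0 := by
  obtain ⟨ha0, hb0⟩ := h0
  induction a using WithBot.recBotCoe with
  | bot =>
    refine ⟨0, -1, -b, le_rfl, by linarith, fun p => ?_, fun x hx => by linarith [hx.2]⟩
    have hI : 0 ≤ (inner ℂ p (R p) : ℂ).re - b * ‖R p‖ ^ 2 := by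
      set δ := (inner ℂ p (R p) : ℂ).re - b * ‖R p‖ ^ 2 with hδ
      -- For every r < 0 the bounded-gap inequality reads κ - r δ ≥ 0. If δ < 0, the value r = (|κ|
      -- + 1)/δ contradicts it.
      set κ := ‖p‖ ^ 2 - b * (inner ℂ p (R p) : ℂ).re with hκ
      by_contra! hneg
      have hs : (|κ| + 1) / δ < 0 := div_neg_of_pos_of_neg (by positivity) hneg
      have h1 := gapForm_nonneg hD hR (hs.trans hb0)
        (fun x _ h2 => hres x ⟨WithBot.bot_lt_coe x, h2⟩) p
      have h2 : (|κ| + 1) / δ * δ = |κ| + 1 := div_mul_cancel₀ _ hneg.ne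
      have h3 : ∀ t : ℝ, gapForm 1 (t + b) (t * b) (R p) p = κ - t * δ := fun t => by
        rw [hκ, hδ]
        unfold gapForm
        ring
      rw [h3, h2] at h1
      linarith [le_abs_self κ]
    unfold gapForm
    linarith
  | coe a =>
    have ha : a < 0 := WithBot.coe_lt_coe.1 ha0
    refine ⟨1, a + b, a * b, zero_le_one, mul_neg_of_neg_of_pos ha hb0,
      gapForm_nonneg hD hR (ha.trans hb0) fun x h1 h2 => hres x ⟨WithBot.coe_lt_coe.2 h1, h2⟩,
      fun x hx => ?_⟩
    have h1 : a < x := WithBot.coe_lt_coe.1 hx.1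
    have h2 := hx.2
    nlinarith

end Resolvent

/-! ### The extensions labelled by operators in subspaces of ker S* -/

section Extension

variable [CompleteSpace H] {S D : H →ₗ.[ℂ] H}

theorem graph_le_graph_adjoint (hd : Dense (S.domain : Set H)) (hSD : S ≤ D)
    (hD : IsSelfAdjoint D) : D.graph ≤ S†.graph := by
  rw [LinearPMap.adjoint_graph_eq_graph_adjoint hd, ← graph_adjoint_eq_of_isSelfAdjoint hD]
  intro x hx
  rw [mem_adjoint_iff_inner_eq] at hx ⊢
  exact fun p hp => hx p (LinearPMap.le_graph_of_le hSD hp)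

theorem mem_eigenspace_adjoint_zero_iff (hd : Dense (S.domain : Set H)) {x : H} :
    x ∈ eigenspace S† 0 ↔ ∀ p ∈ S.graph, inner ℂ p.2 x = 0 := by
  rw [mem_eigenspace_iff, zero_smul, LinearPMap.adjoint_graph_eq_graph_adjoint hd,
    mem_adjoint_iff_inner_eq]
  simp only [inner_zero_right]

theorem isClosed_eigenspace_adjoint_zero (hd : Dense (S.domain : Set H)) :
    IsClosed (eigenspace S† 0 : Set H) := by
  have : (eigenspace S† 0 : Set H) = ⋂ p ∈ S.graph, {x | inner ℂ p.2 x = 0} := by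
    ext x
    simp only [SetLike.mem_coe, mem_eigenspace_adjoint_zero_iff hd, Set.mem_iInter,
      Set.mem_ofPred_eq]
  rw [this]
  exact isClosed_biInter fun p _ => isClosed_eq (by fun_prop) (by fun_prop)

theorem isClosable_of_le_isSelfAdjoint (hSD : S ≤ D) (hD : IsSelfAdjoint D) : S.IsClosable :=
  hD.isClosed.isClosable.leIsClosable hSD

/-- The graph of the closure of `S` consists of all `(R p, p)` with `p` orthogonal to `ker S*`. -/
theorem mem_graph_closure_iff {R : H →L[ℂ] H} (hd : Dense (S.domain : Set H)) (hSD : S ≤ D)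
    (hD : IsSelfAdjoint D) (hR : IsBoundedInverse D 0 R) {x p : H} :
    (x, p) ∈ S.closure.graph ↔ x = R p ∧ p ∈ (eigenspace S† 0)ᗮ := by
  have hRS : ∀ q ∈ S.graph, R q.2 = q.1 := fun q hq => by
    have := hR.apply_of_mem_graph (LinearPMap.le_graph_of_le hSD hq)
    rwa [zero_smul, sub_zero] at this
  rw [← (isClosable_of_le_isSelfAdjoint hSD hD).graph_closure_eq_closure_graph]
  constructor
  · intro h
    have hc : IsClosed {q : H × H | q.1 = R q.2 ∧ q.2 ∈ (eigenspace S† 0)ᗮ} :=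
      (isClosed_eq (by fun_prop) (by fun_prop)).inter
        ((Submodule.isClosed_orthogonal _).preimage continuous_snd)
    refine closure_minimal (fun q hq => ?_) hc h
    refine ⟨(hRS q hq).symm, (Submodule.mem_orthogonal' _ _).2 fun n hn => ?_⟩
    exact (mem_eigenspace_adjoint_zero_iff hd).1 hn q hq
  · rintro ⟨rfl, hp⟩
    -- The orthogonal complement of the range of S is ker S*, so p is a limit of values of S;
    -- continuity of R carries the limit to the graph.
    have hp' : p ∈ closure (S.graph.map (LinearMap.snd ℂ H H) : Set H) := by
      rw [← Submodule.topologicalClosure_coe, ← Submodule.orthogonal_orthogonal_eq_closure]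
      refine Submodule.orthogonal_le (fun z hz => ?_) hp
      rw [mem_eigenspace_adjoint_zero_iff hd]
      exact fun q hq => (Submodule.mem_orthogonal _ _).1 hz _ ⟨q, hq, rfl⟩
    have hc : Continuous fun y : H => (R y, y) := by fun_prop
    refine Set.MapsTo.closure ?_ hc hp'
    rintro _ ⟨q, hq, rfl⟩
    have : ((R q.2, q.2) : H × H) = q := Prod.ext (hRS q hq) rfl
    exact this ▸ hq

/-- The summand f of the domain is R p with p orthogonal to ker S*. Since T is densely defined in U,
p and the vector w of the domain combine into an arbitrary element of Uᗮ; conversely, projection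
onto ker S* separates them again. -/
theorem mem_graph_extensionOf_iff (hd : Dense (S.domain : Set H)) (hSD : S ≤ D)
    (hD : IsSelfAdjoint D) (hR : IsBoundedInverse D 0 (boundedInverse D)) {U : Submodule ℂ H}
    (hU : U ≤ eigenspace S† 0) {T : U →ₗ.[ℂ] U} (hT : Dense (T.domain : Set U)) {p : H × H} :
    p ∈ (extensionOf S D U T).graph ↔ ∃ q ∈ T.graph, ∃ w ∈ Uᗮ,
      p = (boundedInverse D ((q.2 : H) + w) + (q.1 : H), (q.2 : H) + w) := by
  set R := boundedInverse D
  have hDS := graph_le_graph_adjoint hd hSD hD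
  have hRg : ∀ y, (R y, y) ∈ S†.graph := fun y => by
    have := hR.mem_graph y
    rw [zero_smul, add_zero] at this
    exact hDS this
  have hUg : ∀ u : U, ((u : H), (0 : H)) ∈ S†.graph := fun u => by
    have := mem_eigenspace_iff.1 (hU u.2)
    rwa [zero_smul] at this
  have hsum : ∀ (u : U) (y : H), (R y + u, y) ∈ S†.graph := fun u y => by
    have := add_mem (hRg y) (hUg u)
    rwa [Prod.mk_add_mk, add_zero] at this
  have hmem : p ∈ (extensionOf S D U T).graph ↔ p.1 ∈ extensionDomain S D U T ∧ p ∈ S†.graph := by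
    rw [LinearPMap.mem_graph_iff, LinearPMap.mem_graph_iff]
    constructor
    · rintro ⟨y, hy1, hy2⟩
      refine ⟨hy1 ▸ y.2.1, ⟨y, y.2.2⟩, hy1, ?_⟩
      rw [← hy2]
      exact (LinearPMap.domRestrict_apply rfl).symm
    · rintro ⟨h1, y, hy1, hy2⟩
      refine ⟨⟨y, hy1.symm ▸ h1, y.2⟩, hy1, ?_⟩
      rw [← hy2]
      exact LinearPMap.domRestrict_apply rfl
  rw [hmem]
  have hTU : ∀ w : H, (∀ x : T.domain, inner ℂ ((x : U) : H) w = 0) → w ∈ Uᗮ := by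
    intro w hw
    rw [Submodule.mem_orthogonal]
    intro u hu
    have hc : IsClosed {x : U | inner ℂ (x : H) w = 0} := isClosed_eq (by fun_prop) (by fun_prop)
    exact closure_minimal (show (T.domain : Set U) ⊆ _ from fun x hx => hw ⟨x, hx⟩) hc (hT ⟨u, hu⟩)
  constructor
  · rintro ⟨⟨f, hf, x, w, hw, hxw, hp⟩, hpS⟩
    obtain ⟨hf1, hf2⟩ := (mem_graph_closure_iff hd hSD hD hR).1 (S.closure.mem_graph ⟨f, hf⟩)
    have hp1 : p.1 = R ((T x : H) + (w + S.closure ⟨f, hf⟩)) + ((x : U) : H) := by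
      rw [hp, ← add_assoc, map_add R _ (S.closure ⟨f, hf⟩), ← hf1, add_comm f]
    refine ⟨(x, T x), T.mem_graph x, w + S.closure ⟨f, hf⟩,
      add_mem (hTU w hxw) (Submodule.orthogonal_le hU hf2), ?_⟩
    exact Prod.ext hp1 (S†.mem_graph_snd_inj hpS (hsum _ _) hp1)
  · rintro ⟨q, hq, w, hw, rfl⟩
    refine ⟨?_, hsum _ _⟩
    obtain ⟨x, hx1, hx2⟩ := LinearPMap.mem_graph_iff _ |>.1 hq
    have : CompleteSpace (eigenspace S† 0) :=
      (isClosed_eigenspace_adjoint_zero hd).completeSpace_coe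
    set P := (eigenspace S† 0).starProjection
    have hf := (mem_graph_closure_iff hd hSD hD hR (x := R (w - P w)) (p := w - P w)).2
      ⟨rfl, Submodule.sub_starProjection_mem_orthogonal w⟩
    refine ⟨R (w - P w), LinearPMap.mem_domain_of_mem_graph hf, x, P w,
      Submodule.starProjection_apply_mem _ _, fun y => ?_, ?_⟩
    · rw [← Submodule.inner_starProjection_left_eq_right,
        Submodule.starProjection_eq_self_iff.2 (hU (y : U).2)]
      exact (Submodule.mem_orthogonal _ _).1 hw _ (y : U).2
    · rw [← hx1, ← hx2]
      simp only [map_sub, map_add]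
      abel

theorem le_extensionOf (hd : Dense (S.domain : Set H)) (hSD : S ≤ D)
    (hD : IsSelfAdjoint D) (hR : IsBoundedInverse D 0 (boundedInverse D)) {U : Submodule ℂ H}
    (hU : U ≤ eigenspace S† 0) {T : U →ₗ.[ℂ] U} (hT : Dense (T.domain : Set U)) :
    S ≤ extensionOf S D U T := by
  refine LinearPMap.le_of_le_graph fun p hp => ?_
  obtain ⟨h1, h2⟩ := (mem_graph_closure_iff hd hSD hD hR).1
    (LinearPMap.le_graph_of_le S.le_closure hp)
  refine (mem_graph_extensionOf_iff hd hSD hD hR hU hT).2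
    ⟨0, zero_mem _, p.2, Submodule.orthogonal_le hU h2, ?_⟩
  ext <;> simp [h1]

/-- For a pair (g, k) of the adjoint, testing with the zero pair of T and arbitrary w in Uᗮ puts g -
R k in U; testing with w = 0 puts (g - R k, P k) in the adjoint of T, which is T. -/
theorem isSelfAdjoint_extensionOf (hd : Dense (S.domain : Set H)) (hSD : S ≤ D)
    (hD : IsSelfAdjoint D) (hR : IsBoundedInverse D 0 (boundedInverse D)) {U : Submodule ℂ H}
    [U.HasOrthogonalProjection] [CompleteSpace U] (hU : U ≤ eigenspace S† 0) {T : U →ₗ.[ℂ] U}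
    (hT : IsSelfAdjoint T) : IsSelfAdjoint (extensionOf S D U T) := by
  have hg := fun p => mem_graph_extensionOf_iff hd hSD hD hR hU hT.dense_domain (p := p)
  have hRs : ∀ x y, inner ℂ (boundedInverse D x) y = inner ℂ x (boundedInverse D y) := by
    have hR' : IsBoundedInverse D ((0 : ℝ) : ℂ) (boundedInverse D) := by simpa using hR
    exact hR'.inner_symm hD
  have hTa := graph_adjoint_eq_of_isSelfAdjoint hT
  refine isSelfAdjoint_of_graph_adjoint_eq
    (hd.mono (le_extensionOf hd hSD hD hR hU hT.dense_domain).1) (le_antisymm ?_ ?_)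
  · intro p hp
    rw [mem_adjoint_iff_inner_eq] at hp
    have hp' : ∀ q ∈ T.graph, ∀ w ∈ Uᗮ, inner ℂ ((q.2 : H) + w) (p.1 - boundedInverse D p.2) =
        inner ℂ (q.1 : H) p.2 := fun q hq w hw => by
      have := hp _ ((hg _).2 ⟨q, hq, w, hw, rfl⟩)
      simp only at this
      rw [inner_add_left (boundedInverse D _), hRs] at this
      rw [inner_sub_right, this]
      ring
    have hU0 : p.1 - boundedInverse D p.2 ∈ U := by
      rw [← U.orthogonal_orthogonal, Submodule.mem_orthogonal]
      intro w hw
      have := hp' 0 (zero_mem _) w hw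
      rwa [Prod.snd_zero, Prod.fst_zero, Submodule.coe_zero, zero_add, inner_zero_left] at this
    have hTg : ((⟨_, hU0⟩, U.orthogonalProjectionOnto p.2) : U × U) ∈ T.graph := by
      rw [← hTa, mem_adjoint_iff_inner_eq]
      intro q hq
      have := hp' q hq 0 (zero_mem _)
      rw [add_zero] at this
      rw [inner_orthogonalProjectionOnto_right]
      exact this
    refine (hg p).2 ⟨_, hTg, p.2 - U.starProjection p.2, U.sub_starProjection_mem_orthogonal _, ?_⟩
    simp only
    rw [← Submodule.starProjection_apply, add_sub_cancel, add_sub_cancel]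
  · intro p hp
    rw [mem_adjoint_iff_inner_eq]
    intro q hq
    obtain ⟨x, hx, w, hw, rfl⟩ := (hg p).1 hp
    obtain ⟨y, hy, z, hz, rfl⟩ := (hg q).1 hq
    have h1 := inner_symm_of_mem_graph hT hx hy
    rw [Submodule.coe_inner, Submodule.coe_inner] at h1
    have h2 := Submodule.inner_right_of_mem_orthogonal y.1.2 hw
    have h3 := Submodule.inner_left_of_mem_orthogonal x.1.2 hz
    simp only
    rw [inner_add_right _ (boundedInverse D _), inner_add_left (boundedInverse D _), hRs,
      inner_add_left _ z (x.1 : H), inner_add_right (y.1 : H), h1, h2, h3]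

end Extension

/-! ### Orthonormal systems of eigenvectors of S* -/

section Existence

/-- Projection onto a finite-dimensional space cannot be injective on E. This lets the v_n be chosen
one after another. -/
theorem exists_mem_norm_eq_one_orthogonal {E : Submodule ℂ H} (hE : ¬ FiniteDimensional ℂ E)
    {κ : Type*} [Finite κ] (g : κ → H) :
    ∃ x ∈ E, ‖x‖ = 1 ∧ ∀ m, inner ℂ (g m) x = 0 := by
  set G := Submodule.span ℂ (Set.range g)
  have : FiniteDimensional ℂ G := FiniteDimensional.span_of_finite ℂ (Set.finite_range g)
  set f : E →ₗ[ℂ] G := (G.orthogonalProjectionOnto : H →ₗ[ℂ] G) ∘ₗ E.subtype with hf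
  have hker : ¬ Function.Injective f := fun h => hE (FiniteDimensional.of_injective f h)
  rw [← LinearMap.ker_eq_bot, Submodule.eq_bot_iff] at hker
  push Not at hker
  obtain ⟨x, hx, hx0⟩ := hker
  have hxG : (x : H) ∈ Gᗮ := Submodule.orthogonalProjectionOnto_eq_zero_iff.1 hx
  have hx0' : (x : H) ≠ 0 := fun h => hx0 (Subtype.ext h)
  refine ⟨((‖(x : H)‖⁻¹ : ℝ) : ℂ) • (x : H), E.smul_mem _ x.2, ?_, fun m => ?_⟩
  · rw [norm_smul, Complex.norm_real, norm_inv, norm_norm, inv_mul_cancel₀ (norm_ne_zero_iff.2 hx0')]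
  · rw [inner_smul_right,
      Submodule.inner_right_of_mem_orthogonal (K := G) (Submodule.subset_span ⟨m, rfl⟩) hxG,
      mul_zero]

/-- A sequence in which each vector is chosen depending on the preceding ones. -/
def recursiveChoice {P : ∀ n : ℕ, (Fin n → H) → H → Prop} (h : ∀ n g, ∃ x, P n g x) (n : ℕ) : H :=
  (h n fun m : Fin n => recursiveChoice h m).choose
termination_by n
decreasing_by exact m.2

omit [NormedAddCommGroup H] [InnerProductSpace ℂ H] in
theorem recursiveChoice_spec {P : ∀ n : ℕ, (Fin n → H) → H → Prop} (h : ∀ n g, ∃ x, P n g x)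
    (n : ℕ) : P n (fun m => recursiveChoice h m) (recursiveChoice h n) := by
  have he : recursiveChoice h n = (h n fun m : Fin n => recursiveChoice h m).choose := by
    rw [recursiveChoice]
  rw [he]
  exact (h n fun m : Fin n => recursiveChoice h m).choose_spec

theorem exists_orthonormal_seq (E : ℕ → Submodule ℂ H) (hE : ∀ n, ¬ FiniteDimensional ℂ (E n)) :
    ∃ w : ℕ → H, Orthonormal ℂ w ∧ ∀ n, w n ∈ E n := by
  have h : ∀ (n : ℕ) (g : Fin n → H), ∃ x, x ∈ E n ∧ ‖x‖ = 1 ∧ ∀ m, inner ℂ (g m) x = 0 :=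
    fun n g => exists_mem_norm_eq_one_orthogonal (hE n) g
  have hw : ∀ n, recursiveChoice h n ∈ E n ∧ ‖recursiveChoice h n‖ = 1 ∧
      ∀ m : Fin n, inner ℂ (recursiveChoice h m) (recursiveChoice h n) = 0 :=
    recursiveChoice_spec h
  refine ⟨recursiveChoice h, ⟨fun n => (hw n).2.1, fun m n hmn => ?_⟩, fun n => (hw n).1⟩
  rcases lt_or_gt_of_ne hmn with hlt | hlt
  · exact (hw n).2.2 ⟨m, hlt⟩
  · rw [← inner_conj_symm, (hw m).2.2 ⟨n, hlt⟩, map_zero]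

theorem exists_orthonormal_mem {ι : Type*} [Countable ι] (E : ι → Submodule ℂ H)
    (hE : ∀ n, ¬ FiniteDimensional ℂ (E n)) :
    ∃ v : ι → H, Orthonormal ℂ v ∧ ∀ n, v n ∈ E n := by
  rcases isEmpty_or_nonempty ι with hι | hι
  · exact ⟨fun n => hι.elim n, ⟨fun n => hι.elim n, fun n => hι.elim n⟩, fun n => hι.elim n⟩
  obtain ⟨f, hf⟩ := Countable.exists_injective_nat ι
  obtain ⟨w, hw, hwE⟩ := exists_orthonormal_seq (fun k => E (Function.invFun f k)) fun k => hE _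
  refine ⟨w ∘ f, hw.comp f hf, fun n => ?_⟩
  have := hwE (f n)
  rwa [Function.leftInverse_invFun hf n] at this

variable [CompleteSpace H]

theorem sub_smul_mem_eigenspace_adjoint {S D : H →ₗ.[ℂ] H} {R : H →L[ℂ] H} (hDS : D.graph ≤ S†.graph)
    (hR : IsBoundedInverse D 0 R) {z : ℂ} {x : H} (hx : x ∈ eigenspace S† z) :
    x - z • R x ∈ eigenspace S† 0 := by
  rw [mem_eigenspace_iff] at hx ⊢
  have h1 := hDS (hR.mem_graph x)
  have h2 := sub_mem hx (S†.graph.smul_mem z h1)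
  rw [zero_smul, add_zero, Prod.smul_mk, Prod.mk_sub_mk, sub_self] at h2
  rwa [zero_smul]

/-- The map 1 - z R sends ker (S* - z) onto a space containing ker S*: a preimage of u is u + z R'
u, because R (u + z R' u) = R' u. -/
theorem not_finiteDimensional_eigenspace {S D : H →ₗ.[ℂ] H} {R R' : H →L[ℂ] H}
    (hDS : D.graph ≤ S†.graph) (hR : IsBoundedInverse D 0 R) {z : ℂ} (hR' : IsBoundedInverse D z R')
    (hdef : ¬ FiniteDimensional ℂ (eigenspace S† 0)) :
    ¬ FiniteDimensional ℂ (eigenspace S† z) := by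
  intro hfin
  set f : H →ₗ[ℂ] H := LinearMap.id - z • (R : H →ₗ[ℂ] H) with hf
  have hle : eigenspace S† 0 ≤ (eigenspace S† z).map f := by
    intro u hu
    rw [mem_eigenspace_iff, zero_smul] at hu
    have h1 := hR'.mem_graph u
    have h2 := hR.apply_of_mem_graph h1
    rw [zero_smul, sub_zero] at h2
    refine ⟨u + z • R' u, ?_, ?_⟩
    · rw [SetLike.mem_coe, mem_eigenspace_iff]
      have h3 := add_mem hu (S†.graph.smul_mem z (hDS h1))
      rwa [Prod.smul_mk, Prod.mk_add_mk, zero_add] at h3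
    · rw [hf, LinearMap.sub_apply, LinearMap.id_apply, LinearMap.smul_apply,
        ContinuousLinearMap.coe_coe, h2, add_sub_cancel_right]
  exact hdef (Submodule.finiteDimensional_of_le hle)

end Existence

/-! ### The operator T_0 and the eigenvalues of the extension -/

section Main

variable {ι : Type*} {lam : ι → ℝ} {v : ι → H} {D : H →ₗ.[ℂ] H} {α β γ : ℝ}

theorem encard_le_toENat_rank {A : H →ₗ.[ℂ] H} (hv : Orthonormal ℂ v)
    (h : ∀ n, v n ∈ eigenspace A (lam n : ℂ)) (n : ι) :
    {k : ι | lam k = lam n}.encard ≤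
      Cardinal.toENat (Module.rank ℂ (eigenspace A (lam n : ℂ))) := by
  let w : {k : ι | lam k = lam n} → eigenspace A (lam n : ℂ) := fun k => ⟨v k, by
    have := h k
    rwa [show lam k = lam n from k.2] at this⟩
  have hw : LinearIndependent ℂ w := by
    refine LinearIndependent.of_comp (eigenspace A (lam n : ℂ)).subtype ?_
    exact hv.linearIndependent.comp _ Subtype.val_injective
  have := OrderHomClass.mono Cardinal.toENat hw.cardinal_lift_le_rank
  rwa [Cardinal.toENat_lift, Cardinal.toENat_lift] at this

theorem inner_uVec_eq (hR : ∀ x y, inner ℂ (boundedInverse D x) y = inner ℂ x (boundedInverse D y))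
    (m n : ι) : inner ℂ (uVec D lam v m) ((lam n : ℂ) • v n) = matrixElement D lam v m n := by
  rw [matrixElement, uVec, inner_sub_left, inner_smul_left, hR, Complex.conj_ofReal, map_smul,
    inner_smul_right, inner_smul_right]
  ring

theorem uVec_mem_uSpace (D : H →ₗ.[ℂ] H) (lam : ι → ℝ) (v : ι → H) (n : ι) :
    uVec D lam v n ∈ uSpace D lam v := mem_closedSpan _ n

variable [CompleteSpace H]

theorem setOf_eq_range_compress
    (hR : ∀ x y, inner ℂ (boundedInverse D x) y = inner ℂ x (boundedInverse D y)) :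
    {p : uSpace D lam v × uSpace D lam v | ∃ n : ι, (p.1 : H) = uVec D lam v n ∧
      ∀ m : ι, inner ℂ (uVec D lam v m) (p.2 : H) = matrixElement D lam v m n} =
    Set.range fun n => compress (uSpace D lam v) (boundedInverse D) (v n, (lam n : ℂ) • v n) := by
  have hu : ∀ n, shifted (boundedInverse D) lam v n ∈ uSpace D lam v := uVec_mem_uSpace D lam v
  have h2 : ∀ m n, inner ℂ (uVec D lam v m)
      ((compress (uSpace D lam v) (boundedInverse D) (v n, (lam n : ℂ) • v n)).2 : H) =
      matrixElement D lam v m n := fun m n => by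
    rw [← inner_uVec_eq hR, compress_snd]
    exact inner_orthogonalProjectionOnto_right ⟨_, hu m⟩ _
  ext p
  constructor
  · rintro ⟨n, hp1, hp2⟩
    refine ⟨n, Prod.ext (Subtype.ext ?_) (Subtype.ext ?_)⟩
    · rw [hp1]
      exact coe_compress_fst hu n
    · rw [eq_comm, ← sub_eq_zero, ← inner_self_eq_zero (𝕜 := ℂ)]
      refine Submodule.inner_right_of_mem_orthogonal (K := uSpace D lam v) (sub_mem p.2.2 ?_)
        (mem_closedSpan_orthogonal.2 fun m => ?_)
      · exact Subtype.mem _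
      · rw [inner_sub_right, hp2, h2, sub_self]
  · rintro ⟨n, rfl⟩
    exact ⟨n, coe_compress_fst hu n, fun m => h2 m n⟩

theorem exists_isSelfAdjoint_extCore
    (hR : ∀ x y, inner ℂ (boundedInverse D x) y = inner ℂ x (boundedInverse D y))
    (hS : Separates (boundedInverse D) lam α β γ) (hv : Orthonormal ℂ v) :
    ∃ T : uSpace D lam v →ₗ.[ℂ] uSpace D lam v, IsSelfAdjoint T ∧
      T.graph = (extCore (uSpace D lam v) (boundedInverse D) lam v).topologicalClosure := by
  have hu : ∀ n, shifted (boundedInverse D) lam v n ∈ uSpace D lam v := uVec_mem_uSpace D lam v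
  refine exists_isSelfAdjoint_of_adjoint_eq _ ?_ (adjoint_extCore_eq hR hS hv hu)
  exact (dense_map_fst_core (U := uSpace D lam v) le_rfl hu).mono
    (Submodule.map_mono (core_le_extCore _))

/-- The span defining T_0 is single-valued because it lies in the graph of a self-adjoint operator;
only then does `toLinearPMap` return an operator with this graph. -/
theorem graph_birmanCore
    (hR : ∀ x y, inner ℂ (boundedInverse D x) y = inner ℂ x (boundedInverse D y))
    (hS : Separates (boundedInverse D) lam α β γ) (hv : Orthonormal ℂ v) :
    (birmanCore D lam v).graph = core (uSpace D lam v) (boundedInverse D) lam v := by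
  obtain ⟨T, -, hT⟩ := exists_isSelfAdjoint_extCore hR hS hv
  rw [birmanCore, setOf_eq_range_compress hR]
  refine Submodule.toLinearPMap_graph_eq _ fun p hp hp0 => ?_
  have hpT : p ∈ T.graph :=
    hT ▸ Submodule.le_topologicalClosure _ (core_le_extCore _ hp)
  exact T.graph_fst_eq_zero_snd hpT hp0

theorem mem_eigenspace_extensionOf {S : H →ₗ.[ℂ] H} (hd : Dense (S.domain : Set H)) (hSD : S ≤ D)
    (hD : IsSelfAdjoint D) (hDR : IsBoundedInverse D 0 (boundedInverse D))
    (hR : ∀ x y, inner ℂ (boundedInverse D x) y = inner ℂ x (boundedInverse D y))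
    (hS : Separates (boundedInverse D) lam α β γ) (hv : Orthonormal ℂ v)
    (hU : uSpace D lam v ≤ eigenspace S† 0) {T : uSpace D lam v →ₗ.[ℂ] uSpace D lam v}
    (hT : IsSelfAdjoint T) (hle : birmanCore D lam v ≤ T) (n : ι) :
    v n ∈ eigenspace (extensionOf S D (uSpace D lam v) T) (lam n : ℂ) := by
  have hmem : compress (uSpace D lam v) (boundedInverse D) (v n, (lam n : ℂ) • v n) ∈ T.graph := by
    refine LinearPMap.le_graph_of_le hle ?_
    rw [graph_birmanCore hR hS hv]
    exact Submodule.subset_span ⟨n, rfl⟩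
  rw [mem_eigenspace_iff, mem_graph_extensionOf_iff hd hSD hD hDR hU hT.dense_domain]
  -- Here w = (1 - P)(λ_n v_n), so the second entry is λ_n v_n and the first is R(λ_n v_n) + u_n =
  -- v_n.
  refine ⟨_, hmem, _, Submodule.sub_starProjection_mem_orthogonal ((lam n : ℂ) • v n), ?_⟩
  rw [coe_compress_fst (uVec_mem_uSpace D lam v), compress_snd, ← Submodule.starProjection_apply,
    add_sub_cancel, map_smul, shifted, add_sub_cancel]

theorem isSelfAdjoint_closure_birmanCore
    (hR : ∀ x y, inner ℂ (boundedInverse D x) y = inner ℂ x (boundedInverse D y))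
    (hS : Separates (boundedInverse D) lam α β γ) (hv : Orthonormal ℂ v) {ε M : ℝ} (hε : 0 < ε)
    (hM : ∀ n, |lam n| ≤ M) (hlam : ∀ n, α * lam n ^ 2 - β * lam n + γ ≤ -ε) :
    IsSelfAdjoint (birmanCore D lam v).closure := by
  obtain ⟨T, hTs, hT⟩ := exists_isSelfAdjoint_extCore hR hS hv
  rw [extCore_eq_core (U := uSpace D lam v) hv hS le_rfl hε hM hlam, ← graph_birmanCore hR hS hv] at hT
  have hle : birmanCore D lam v ≤ T := LinearPMap.le_of_le_graph (by
    rw [hT]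
    exact Submodule.le_topologicalClosure _)
  rw [(isClosable_of_le_isSelfAdjoint hle hTs).graph_closure_eq_closure_graph] at hT
  rwa [← LinearPMap.eq_of_eq_graph hT]

end Main

theorem exists_bounds_of_isCompact {a : WithBot ℝ} {b : ℝ} {f : ℝ → ℝ} (hf : Continuous f)
    (hneg : ∀ x ∈ gapInterval a b, f x < 0) {K : Set ℝ} (hK : IsCompact K)
    (hKs : K ⊆ gapInterval a b) : ∃ ε M : ℝ, 0 < ε ∧ ∀ x ∈ K, |x| ≤ M ∧ f x ≤ -ε := by
  rcases K.eq_empty_or_nonempty with rfl | hne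
  · exact ⟨1, 0, one_pos, fun x hx => hx.elim⟩
  obtain ⟨y, hy, hmax⟩ := hK.exists_isMaxOn hne hf.continuousOn
  obtain ⟨M, hM⟩ := hK.isBounded.exists_norm_le
  exact ⟨-f y, M, neg_pos.2 (hneg y (hKs hy)), fun x hx => ⟨hM x hx, by
    rw [neg_neg]; exact hmax hx⟩⟩

end

end GapExtension

theorem mainTheorem1 {H : Type*} [NormedAddCommGroup H] [InnerProductSpace ℂ H] [CompleteSpace H]
    (S D : H →ₗ.[ℂ] H) (a : WithBot ℝ) (b : ℝ)
    (hdense : Dense (S.domain : Set H)) (hsymm : S.IsFormalAdjoint S)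
    (h0 : (0 : ℝ) ∈ GapExtension.gapInterval a b)
    (hgap : GapExtension.HasGap S a b)
    (hD : GapExtension.IsDistinguishedExtension S D a b)
    (hdef : ¬ FiniteDimensional ℂ (GapExtension.eigenspace S† 0))
    {ι : Type*} [Countable ι] (lam : ι → ℝ)
    (hlam : ∀ n, lam n ∈ GapExtension.gapInterval a b) :
    -- orthonormal systems `v` with `S* v_n = λ_n v_n` exist
    (∃ v : ι → H, Orthonormal ℂ v ∧ ∀ n, v n ∈ GapExtension.eigenspace S† (lam n : ℂ)) ∧
    ∀ v : ι → H, Orthonormal ℂ v → (∀ n, v n ∈ GapExtension.eigenspace S† (lam n : ℂ)) →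
      -- the `u_n` are linearly independent, and `U` is a subspace of `ker S*`
      LinearIndependent ℂ (GapExtension.uVec D lam v) ∧
      GapExtension.uSpace D lam v ≤ GapExtension.eigenspace S† 0 ∧
      -- the operator on the span of the `u_n` has the prescribed matrix elements
      (∀ n, ∃ x : (GapExtension.birmanCore D lam v).domain,
        ((x : GapExtension.uSpace D lam v) : H) = GapExtension.uVec D lam v n ∧
        ∀ m, inner ℂ (GapExtension.uVec D lam v m)
          (GapExtension.birmanCore D lam v x : H) = GapExtension.matrixElement D lam v m n) ∧
      -- its closure is self-adjoint if the `λ_n` stay in a compact subset of the gap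
      ((∃ K : Set ℝ, IsCompact K ∧ K ⊆ GapExtension.gapInterval a b ∧ ∀ n, lam n ∈ K) →
        IsSelfAdjoint (GapExtension.birmanCore D lam v).closure) ∧
      -- in general it has a self-adjoint extension `T` in `U`
      (∃ T : GapExtension.uSpace D lam v →ₗ.[ℂ] GapExtension.uSpace D lam v,
        IsSelfAdjoint T ∧ GapExtension.birmanCore D lam v ≤ T) ∧
      -- for each such `T`, in particular for the closure if that is self-adjoint:
      ∀ T : GapExtension.uSpace D lam v →ₗ.[ℂ] GapExtension.uSpace D lam v,
        IsSelfAdjoint T → GapExtension.birmanCore D lam v ≤ T →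
        S ≤ GapExtension.extensionOf S D (GapExtension.uSpace D lam v) T ∧
        IsSelfAdjoint (GapExtension.extensionOf S D (GapExtension.uSpace D lam v) T) ∧
        ∀ n,
          GapExtension.eigenspace
            (GapExtension.extensionOf S D (GapExtension.uSpace D lam v) T) (lam n : ℂ) ≠ ⊥ ∧
          {k : ι | lam k = lam n}.encard ≤
            Cardinal.toENat (Module.rank ℂ (GapExtension.eigenspace
              (GapExtension.extensionOf S D (GapExtension.uSpace D lam v) T) (lam n : ℂ))) := by
  have h0D : GapExtension.InResolventSet D 0 := by simpa using hD.gap_subset 0 h0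
  have hR0 := GapExtension.isBoundedInverse_boundedInverse h0D
  have hR : ∀ x y, inner ℂ (GapExtension.boundedInverse D x) y =
      inner ℂ x (GapExtension.boundedInverse D y) := by
    have hR' : GapExtension.IsBoundedInverse D ((0 : ℝ) : ℂ) (GapExtension.boundedInverse D) := by
      simpa using hR0
    exact hR'.inner_symm hD.selfAdjoint
  have hDS := GapExtension.graph_le_graph_adjoint hdense hD.extends_op hD.selfAdjoint
  obtain ⟨α, β, γ, hα, hγ, hform, hneg⟩ :=
    GapExtension.exists_gapForm hD.selfAdjoint hR0 h0 hD.gap_subset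
  have hS : GapExtension.Separates (GapExtension.boundedInverse D) lam α β γ :=
    ⟨hα, hγ, hform, fun n => hneg _ (hlam n)⟩
  refine ⟨?_, fun v hv hvS => ?_⟩
  · refine GapExtension.exists_orthonormal_mem _ fun n => ?_
    obtain ⟨R', hR'⟩ := hD.gap_subset _ (hlam n)
    exact GapExtension.not_finiteDimensional_eigenspace hDS hR0 hR' hdef
  have hU : GapExtension.uSpace D lam v ≤ GapExtension.eigenspace S† 0 := by
    refine Submodule.topologicalClosure_minimal _ (Submodule.span_le.2 ?_)
      (GapExtension.isClosed_eigenspace_adjoint_zero hdense)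
    rintro _ ⟨n, rfl⟩
    exact GapExtension.sub_smul_mem_eigenspace_adjoint hDS hR0 (hvS n)
  refine ⟨GapExtension.linearIndependent_sub_smul hS hv, hU, fun n => ?_, ?_, ?_, ?_⟩
  · have hmem : GapExtension.compress (GapExtension.uSpace D lam v)
        (GapExtension.boundedInverse D) (v n, (lam n : ℂ) • v n) ∈
        (GapExtension.birmanCore D lam v).graph := by
      rw [GapExtension.graph_birmanCore hR hS hv]
      exact Submodule.subset_span ⟨n, rfl⟩
    obtain ⟨x, hx1, hx2⟩ := LinearPMap.mem_graph_iff _ |>.1 hmem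
    have hu := GapExtension.uVec_mem_uSpace D lam v
    refine ⟨x, ?_, fun m => ?_⟩
    · rw [hx1]
      exact GapExtension.coe_compress_fst hu n
    · rw [hx2, ← GapExtension.inner_uVec_eq hR]
      exact GapExtension.inner_orthogonalProjectionOnto_right ⟨_, hu m⟩ _
  · rintro ⟨K, hK, hKs, hlamK⟩
    obtain ⟨ε, M, hε, hb⟩ := GapExtension.exists_bounds_of_isCompact
      (f := fun x => α * x ^ 2 - β * x + γ) (by fun_prop) hneg hK hKs
    exact GapExtension.isSelfAdjoint_closure_birmanCore hR hS hv hε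
      (fun n => (hb _ (hlamK n)).1) fun n => (hb _ (hlamK n)).2
  · obtain ⟨T, hTs, hT⟩ := GapExtension.exists_isSelfAdjoint_extCore hR hS hv
    refine ⟨T, hTs, LinearPMap.le_of_le_graph ?_⟩
    rw [hT, GapExtension.graph_birmanCore hR hS hv]
    exact (GapExtension.core_le_extCore _).trans (Submodule.le_topologicalClosure _)
  · intro T hT hle
    have hmem := GapExtension.mem_eigenspace_extensionOf hdense hD.extends_op hD.selfAdjoint hR0
      hR hS hv hU hT hle
    refine ⟨GapExtension.le_extensionOf hdense hD.extends_op hD.selfAdjoint hR0 hU hT.dense_domain,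
      GapExtension.isSelfAdjoint_extensionOf hdense hD.extends_op hD.selfAdjoint hR0 hU hT,
      fun n => ⟨fun hbot => ?_, GapExtension.encard_le_toENat_rank hv hmem n⟩⟩
    have h1 := hmem n
    rw [hbot, Submodule.mem_bot] at h1
    exact hv.ne_zero n h1
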